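/- Let $f_0,f_1$ be probability densities with respect to a $\sigma$-finite measure $\mu$ on a measurable space. For $k\in\{1,2,\dots\}\cup\{\infty\}$ let $\mathbf P_k$ be the law of independent observations $X_1,X_2,\dots$ such that $X_i$ has density $f_0$ for $i<k$ and density $f_1$ for $i\ge k$ (so that under $\mathbf P_\infty$ all observations have density $f_0$), and let $\mathbf E_k$ be the corresponding expectation. Let $\pi=(\pi_k)_{k\ge1}$ be a prior probability distribution of the change point $\lambda\in\{1,2,\dots\}$, let $\mathbf P^\pi=\sum_{k\ge1}\pi_k\mathbf P_k$ be the joint law of $\lambda$ and the observations (given $\lambda=k$ the observations have law $\mathbf P_k$), and let $\mathbf E^\pi$ be its expectation. For a stopping time $\tau$ with values in $\{0,1,2,\dots\}\cup\{\infty\}$ with respect to $\mathcal F_n=\sigma(X_1,\dots,X_n)$, $n\ge0$, and for $m>0$, put $$D_m^\pi(\tau)=\mathbf E^\pi[(\tau-\lambda)^m\mid\tau\ge\lambda]=\frac{\sum_{k\ge1}\pi_k\,\mathbf E_k[(\tau-k)^m;\,\tau\ge k]}{\sum_{k\ge1}\pi_k\,\mathbf P_k(\tau\ge k)}\in[0,\infty].$$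 For $0<\alpha<1$ let $\Delta_\infty(\alpha)$ be the class of all such stopping times with $\mathbf P_\infty(\tau<\infty)\le\alpha$. For $A>1$ let $$\tau_A=\min\{n\ge1: G_n\ge A\},\qquad G_n=\sum_{k=1}^\infty\pi_k\prod_{i=k}^n\frac{f_1(X_i)}{f_0(X_i)},$$ where $\min\emptyset=\infty$ and empty products are $1$. Let $I=\int\log\frac{f_1(x)}{f_0(x)}\,f_1(x)\,d\mu(x)$ be the Kullback–Leibler information number (with $I=\infty$ if $f_1\,d\mu$ is not absolutely continuous with respect to $f_0\,d\mu$). Suppose that $0<I<\infty$, let $m>0$ be a real number (in particular, any $m\ge1$), and suppose that $\sum_{k=1}^\infty|\log\pi_k|^m\pi_k<\infty$ (terms with $\pi_k=0$ being $0$). Write $u\sim v$ if $u/v\to1$. Then: (i) as $A\to\infty$, $D_m^\pi(\tau_A)\sim\left(\frac{\log A}{I}\right)^m$; (ii) for every $\alpha\in(0,1)$, with $A_\alpha=1/\alpha$, the stopping time $\tau_{A_\alpha}$ belongs to $\Delta_\infty(\alpha)$, and, as $\alpha\to0$, $$\inf_{\tau\in\Delta_\infty(\alpha)}D_m^\pi(\tau)\sim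 D_m^\pi(\tau_{A_\alpha})\sim\left(\frac{|\log\alpha|}{I}\right)^m.$$ -/

import Mathlib

open MeasureTheory ProbabilityTheory Filter
open scoped ENNReal NNReal Topology

namespace ChangePoint

/-- A probability density with respect to the measure `μ`. -/
structure ProbDensity {E : Type*} [MeasurableSpace E] (μ : Measure E) where
  toFun : E → ℝ≥0
  measurable_toFun : Measurable toFun
  lintegral_eq_one : ∫⁻ x, (toFun x : ℝ≥0∞) ∂μ = 1

section Model

variable {E : Type*} [MeasurableSpace E] {μ : Measure E}

/-- The distribution `f dμ` on `E` with density `f`. -/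
noncomputable def ProbDensity.law (f : ProbDensity μ) : Measure E :=
  μ.withDensity fun x => (f.toFun x : ℝ≥0∞)

instance (f : ProbDensity μ) : IsProbabilityMeasure f.law :=
  ⟨by simp [ProbDensity.law, f.lintegral_eq_one]⟩

/-- The Kullback-Leibler information number `I(f₁, f₀) = ∫ log (f₁ / f₀) f₁ dμ ∈ [0, ∞]`. -/
noncomputable def klNumber (f₁ f₀ : ProbDensity μ) : ℝ≥0∞ :=
  InformationTheory.klDiv f₁.law f₀.law

/-- The law of the observations `X = (X_0, X_1, X_2, …)`, realized as the coordinates of `ℕ → E`,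
when the change happens at `k`: they are independent, `X_i` has density `f₀` for `i < k` and `f₁`
for `i ≥ k`. `k = ⊤` means that no change occurs. The actual observations are `X_1, X_2, …`; the
coordinate `X_0` is a placeholder which neither the filtration nor the statistics below use. -/
noncomputable def changeMeasure (f₀ f₁ : ProbDensity μ) (k : ℕ∞) : Measure (ℕ → E) :=
  Measure.infinitePi fun i : ℕ => if (i : ℕ∞) < k then f₀.law else f₁.law

/-- The filtration `ℱ_n = σ(X_1, …, X_n)`, with `ℱ_0` trivial. -/
def obsFiltration (E : Type*) [MeasurableSpace E] :
    Filtration ℕ (MeasurableSpace.pi : MeasurableSpace (ℕ → E)) where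
  seq n := ⨆ i ∈ Finset.Icc 1 n,
    MeasurableSpace.comap (fun ω : ℕ → E => ω i) inferInstance
  mono' _ _ hij := biSup_mono fun _ hk => Finset.Icc_subset_Icc_right hij hk
  le' _ := iSup₂_le fun i _ => (measurable_pi_apply i).comap_le

/-- The average likelihood ratio `G_n = ∑_k π_k ∏_{i=k}^n f₁(X_i) / f₀(X_i)`, where the product is
`1` for `k > n`. The term `k = 0` vanishes for a prior that lives on `{1, 2, …}`. -/
noncomputable def avgLR (f₀ f₁ : ProbDensity μ) (π : PMF ℕ) (n : ℕ) (ω : ℕ → E) : ℝ≥0∞ :=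
  ∑' k : ℕ, π k * ∏ i ∈ Finset.Icc k n, ((f₁.toFun (ω i) : ℝ≥0∞) / f₀.toFun (ω i))

/-- The detection procedure `τ_A = min {n ≥ 1 : G_n ≥ A}`, with `min ∅ = ∞`. -/
noncomputable def tauA (f₀ f₁ : ProbDensity μ) (π : PMF ℕ) (A : ℝ) : (ℕ → E) → ℕ∞ :=
  hittingAfter (avgLR f₀ f₁ π) (Set.Ici (ENNReal.ofReal A)) 1

/-- The class of the stopping times `τ` with global false alarm probability
`P_∞(τ < ∞) ≤ α`. -/
def falseAlarmClass (f₀ f₁ : ProbDensity μ) (α : ℝ) : Set ((ℕ → E) → ℕ∞) :=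
  {τ | IsStoppingTime (obsFiltration E) τ ∧
    changeMeasure f₀ f₁ ⊤ {ω | τ ω < ⊤} ≤ ENNReal.ofReal α}

/-- The `m`-th moment of the detection delay,
`D_m^π(τ) = E^π[(τ - λ)^m | τ ≥ λ] = E^π[(τ - λ)^m; τ ≥ λ] / P^π(τ ≥ λ)`, where
`P^π = ∑_k π_k P_k` is the joint law of the observations and of the change point `λ`. It is
infinite if the delay is infinite with positive probability. -/
noncomputable def delayMoment (f₀ f₁ : ProbDensity μ) (π : PMF ℕ) (m : ℝ)
    (τ : (ℕ → E) → ℕ∞) : ℝ≥0∞ :=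
  (∑' k : ℕ, π k *
      ∫⁻ ω in {ω | (k : ℕ∞) ≤ τ ω}, ((τ ω : ℝ≥0∞) - (k : ℝ≥0∞)) ^ m ∂(changeMeasure f₀ f₁ k)) /
    ∑' k : ℕ, π k * changeMeasure f₀ f₁ k {ω | (k : ℕ∞) ≤ τ ω}

end Model

/-- First-order asymptotic equivalence `u ∼ v` along the filter `l`: the ratio tends to `1`. -/
def AsympEquiv {ι : Type*} (l : Filter ι) (u v : ι → ℝ≥0∞) : Prop :=
  Tendsto (fun i => u i / v i) l (𝓝 1)

end ChangePoint

open ChangePoint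

/-! Let `Z_i = log (f₁(X_i)/f₀(X_i))`. After the change the `Z_i` are i.i.d. with mean `I`, so a
likelihood ratio needs about `log A / I` observations to reach level `A`. Upper bound: `G_n ≥ π_k
∏_{i=k}^n f₁/f₀`, so `τ_A` can run past `k + n` only if `Z_k + … + Z_{k+n} < log A + |log π_k|`.
Since `E₁ exp(-Z) ≤ 1`, a Chernoff bound holds at every rate `J < I` with no moment assumption
beyond `I < ∞` (`exists_lintegral_exp_neg_mul_logLR_le`). The delay thus has an exponential tail
beyond `(log A + |log π_k|)/J`. Averaging over the prior leaves `(log A / J)^m`, up to a factor near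
`1` and a constant independent of `A` (`exists_tsum_tauA_delay_le`). Lower bound: changing measure
from `P_k` to `P_∞`, a stopping time with false alarm probability `α` lies in `[k, k+N)` with
`P_k`-probability at most `e^{C+JN} α`, plus the probability that the random walk ever reaches the
line `C + Jn` (`changeMeasure_le_and_lt_add_le`). For `J > I` the strong law makes the latter small
as `C → ∞`. With `N` just below `|log α|/I`, the delay is at least `N` with probability near `1`,
for all such stopping times at once (`eventually_le_delayMoment`). The conditioning event costs
nothing in the limit: `1 - α ≤ P^π(τ ≥ λ) ≤ 1`. -/

namespace ChangePoint

/-! ### Product measures: finite reweighting and events of the observation filtration. -/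

section ProductMeasures

variable {E : Type*} [MeasurableSpace E]

/-- It suffices to check cylinders, where independence factors the integral coordinate by
coordinate. -/
theorem infinitePi_withDensity_prod (P : Measure E) [IsProbabilityMeasure P] {g : E → ℝ≥0∞}
    (hg : Measurable g) [IsProbabilityMeasure (P.withDensity g)] (s : Finset ℕ) (R : ℕ → Measure E)
    [∀ i, IsProbabilityMeasure (R i)] (hR : ∀ i, R i = if i ∈ s then P.withDensity g else P) :
    (Measure.infinitePi fun _ : ℕ => P).withDensity (fun ω => ∏ i ∈ s, g (ω i)) =
      Measure.infinitePi R := by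
  apply Measure.eq_infinitePi
  intro u t ht
  classical
  let h : ℕ → E → ℝ≥0∞ := fun i x =>
    (if i ∈ s then g x else 1) * (if i ∈ u then (t i).indicator 1 x else 1)
  have hh : ∀ i, Measurable (h i) := by
    intro i
    refine Measurable.mul ?_ ?_
    · split_ifs <;> fun_prop
    · split_ifs
      · exact measurable_one.indicator (ht i)
      · fun_prop
  have hmu : MeasurableSet (Set.pi (u : Set ℕ) t) := .pi u.countable_toSet fun _ _ => ht _
  rw [withDensity_apply _ hmu, ← lintegral_indicator hmu]
  have e : ∀ ω : ℕ → E, (Set.pi (u : Set ℕ) t).indicator (fun ω => ∏ i ∈ s, g (ω i)) ω =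
      ∏ i ∈ s ∪ u, h i (ω i) := by
    intro ω
    have h1 : ∏ i ∈ s ∪ u, (if i ∈ s then g (ω i) else 1) = ∏ i ∈ s, g (ω i) := by
      rw [Finset.prod_ite_mem, Finset.union_inter_cancel_left]
    have h2 : ∏ i ∈ s ∪ u, (if i ∈ u then (t i).indicator (1 : E → ℝ≥0∞) (ω i) else 1) =
        ∏ i ∈ u, (t i).indicator (1 : E → ℝ≥0∞) (ω i) := by
      rw [Finset.prod_ite_mem, Finset.union_inter_cancel_right]
    rw [Finset.prod_mul_distrib, h1, h2]
    by_cases hω : ω ∈ Set.pi (u : Set ℕ) t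
    · rw [Set.indicator_of_mem hω, Finset.prod_eq_one (s := u), mul_one]
      intro i hi
      simp [Set.indicator_of_mem (hω i hi)]
    · rw [Set.indicator_of_notMem hω]
      have : ∃ i ∈ u, ω i ∉ t i := by simpa [Set.mem_pi] using hω
      obtain ⟨i, hi, hi'⟩ := this
      rw [Finset.prod_eq_zero hi (by simp [hi']), mul_zero]
  simp_rw [e]
  rw [show ∫⁻ ω, ∏ i ∈ s ∪ u, h i (ω i) ∂(Measure.infinitePi fun _ : ℕ => P) =
      ∏ i ∈ s ∪ u, ∫⁻ ω, h i (ω i) ∂(Measure.infinitePi fun _ : ℕ => P) from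
    lintegral_prod_eq_prod_lintegral_of_indepFun (s ∪ u) (fun i (ω : ℕ → E) => h i (ω i))
      (iIndepFun_infinitePi hh) (fun i => (hh i).comp (measurable_pi_apply i))]
  have key : ∀ i, ∫⁻ ω, h i (ω i) ∂(Measure.infinitePi fun _ : ℕ => P) =
      if i ∈ u then R i (t i) else 1 := by
    intro i
    have : ∫⁻ ω, h i (ω i) ∂(Measure.infinitePi fun _ : ℕ => P) = ∫⁻ x, h i x ∂P := by
      conv_rhs => rw [← Measure.infinitePi_map_eval (fun _ : ℕ => P) i]
      rw [lintegral_map (hh i) (measurable_pi_apply i)]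
    rw [this, hR]
    have hone : ∫⁻ x, g x ∂P = 1 := by
      have := measure_univ (μ := P.withDensity g)
      rwa [withDensity_apply _ .univ, Measure.restrict_univ] at this
    by_cases hs : i ∈ s <;> by_cases hu : i ∈ u <;> simp only [h, hs, hu, if_true, if_false]
    · rw [withDensity_apply _ (ht i), ← lintegral_indicator (ht i)]
      congr 1 with x
      by_cases hx : x ∈ t i <;> simp [hx]
    · simpa using hone
    · simp [lintegral_indicator (ht i)]
    · simp
  rw [Finset.prod_congr rfl fun i _ => key i, Finset.prod_ite_mem, Finset.union_inter_cancel_right]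

theorem exists_preimage_restrict_of_measurableSet_obsFiltration {n : ℕ} {B : Set (ℕ → E)}
    (hB : MeasurableSet[obsFiltration E n] B) :
    ∃ S : Set (Finset.Icc 1 n → E), MeasurableSet S ∧ (Finset.Icc 1 n).restrict ⁻¹' S = B := by
  have : (obsFiltration E n : MeasurableSpace (ℕ → E)) ≤
      MeasurableSpace.comap (Finset.Icc 1 n).restrict MeasurableSpace.pi := by
    refine iSup₂_le fun i hi => ?_
    rw [← measurable_iff_comap_le]
    exact (measurable_pi_apply (⟨i, hi⟩ : Finset.Icc 1 n)).comp
      (comap_measurable (Finset.Icc 1 n).restrict)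
  exact this B hB

theorem infinitePi_congr_of_measurableSet_obsFiltration {P R : ℕ → Measure E}
    [∀ i, IsProbabilityMeasure (P i)] [∀ i, IsProbabilityMeasure (R i)] {n : ℕ}
    (h : ∀ i ∈ Finset.Icc 1 n, P i = R i) {B : Set (ℕ → E)}
    (hB : MeasurableSet[obsFiltration E n] B) :
    Measure.infinitePi P B = Measure.infinitePi R B := by
  obtain ⟨S, hS, rfl⟩ := exists_preimage_restrict_of_measurableSet_obsFiltration hB
  have hm : Measurable ((Finset.Icc 1 n).restrict : (ℕ → E) → _) := by fun_prop
  rw [← Measure.map_apply hm hS, ← Measure.map_apply hm hS, Measure.infinitePi_map_restrict,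
    Measure.infinitePi_map_restrict]
  congr 2
  ext1 i
  exact h i i.2

theorem measurable_obsFiltration_eval {i n : ℕ} (hi : i ∈ Finset.Icc 1 n) :
    Measurable[obsFiltration E n] fun ω : ℕ → E => ω i := by
  rw [measurable_iff_comap_le]
  exact le_iSup₂_of_le (f := fun i (_ : i ∈ Finset.Icc 1 n) =>
    MeasurableSpace.comap (fun ω : ℕ → E => ω i) inferInstance) i hi le_rfl

end ProductMeasures

/-! ### Likelihood ratios and change of measure. -/

section LikelihoodRatio

variable {E : Type*} [MeasurableSpace E] {μ : Measure E} {f₀ f₁ : ProbDensity μ}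

/-- The likelihood ratio `f₁ / f₀` of a single observation. -/
noncomputable def lr (f₀ f₁ : ProbDensity μ) (x : E) : ℝ≥0∞ := (f₁.toFun x : ℝ≥0∞) / f₀.toFun x

theorem measurable_lr (f₀ f₁ : ProbDensity μ) : Measurable (lr f₀ f₁) :=
  f₁.measurable_toFun.coe_nnreal_ennreal.div f₀.measurable_toFun.coe_nnreal_ennreal

theorem ProbDensity.law_setOf_eq_zero (f : ProbDensity μ) : f.law {x | f.toFun x = 0} = 0 := by
  have hm : MeasurableSet {x | f.toFun x = 0} := f.measurable_toFun (measurableSet_singleton 0)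
  rw [ProbDensity.law, withDensity_apply _ hm, setLIntegral_congr_fun hm (g := fun _ => 0)]
  · simp
  · intro x hx
    simpa using hx

theorem law_withDensity_lr (hac : f₁.law ≪ f₀.law) : f₀.law.withDensity (lr f₀ f₁) = f₁.law := by
  have h0 : f₁.law {x | f₀.toFun x = 0} = 0 := hac f₀.law_setOf_eq_zero
  have hm : MeasurableSet {x | f₀.toFun x = 0} := f₀.measurable_toFun (measurableSet_singleton 0)
  have h1 : ∀ᵐ x ∂μ, f₀.toFun x = 0 → f₁.toFun x = 0 := by
    rw [ProbDensity.law, withDensity_apply _ hm,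
      setLIntegral_eq_zero_iff hm f₁.measurable_toFun.coe_nnreal_ennreal] at h0
    simpa using h0
  rw [ProbDensity.law, ProbDensity.law, ← withDensity_mul₀
    f₀.measurable_toFun.coe_nnreal_ennreal.aemeasurable (measurable_lr f₀ f₁).aemeasurable]
  refine withDensity_congr_ae ?_
  filter_upwards [h1] with x hx
  by_cases h : f₀.toFun x = 0
  · simp [h, hx h]
  · simp only [Pi.mul_apply, lr]
    exact ENNReal.mul_div_cancel (by simpa using h) ENNReal.coe_ne_top

theorem ae_lr_ne_zero_and_ne_top (hac : f₁.law ≪ f₀.law) :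
    ∀ᵐ x ∂f₁.law, lr f₀ f₁ x ≠ 0 ∧ lr f₀ f₁ x ≠ ∞ := by
  have h0 : ∀ᵐ x ∂f₁.law, f₀.toFun x ≠ 0 := by
    simpa [ae_iff] using hac f₀.law_setOf_eq_zero
  have h1 : ∀ᵐ x ∂f₁.law, f₁.toFun x ≠ 0 := by
    simpa [ae_iff] using f₁.law_setOf_eq_zero
  filter_upwards [h0, h1] with x hx0 hx1
  refine ⟨?_, ?_⟩
  · simp [lr, ENNReal.div_eq_zero_iff, hx1]
  · exact ENNReal.div_ne_top ENNReal.coe_ne_top (by simpa using hx0)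

instance (k : ℕ∞) : IsProbabilityMeasure (changeMeasure f₀ f₁ k) := by
  unfold changeMeasure
  have : ∀ i : ℕ, IsProbabilityMeasure (if (i : ℕ∞) < k then f₀.law else f₁.law) := by
    intro i; split_ifs <;> infer_instance
  infer_instance

instance (k : ℕ∞) (i : ℕ) : IsProbabilityMeasure (if (i : ℕ∞) < k then f₀.law else f₁.law) := by
  split_ifs <;> infer_instance

/-- The likelihood ratio of the observations `X_k, …, X_n`. -/
noncomputable def lrProd (f₀ f₁ : ProbDensity μ) (k n : ℕ) (ω : ℕ → E) : ℝ≥0∞ :=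
  ∏ i ∈ Finset.Icc k n, lr f₀ f₁ (ω i)

theorem measurable_lrProd (f₀ f₁ : ProbDensity μ) (k n : ℕ) : Measurable (lrProd f₀ f₁ k n) :=
  Finset.measurable_prod _ fun i _ => (measurable_lr f₀ f₁).comp (measurable_pi_apply i)

theorem measurable_obsFiltration_lrProd (f₀ f₁ : ProbDensity μ) {k : ℕ} (hk : 1 ≤ k) (n : ℕ) :
    Measurable[obsFiltration E n] (lrProd f₀ f₁ k n) :=
  Finset.measurable_prod _ fun _ hi => (measurable_lr f₀ f₁).comp
    (measurable_obsFiltration_eval (Finset.Icc_subset_Icc_left hk hi))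

theorem changeMeasure_top_eq : changeMeasure f₀ f₁ ⊤ = Measure.infinitePi fun _ : ℕ => f₀.law := by
  simp [changeMeasure]

/-- Reweighting `P_∞` over `k, …, n` gives a law that agrees with `P_k` up to time `n` only, which
is enough for an event of `ℱ_n`. -/
theorem changeMeasure_apply_eq_setLIntegral (hac : f₁.law ≪ f₀.law) {k n : ℕ}
    {B : Set (ℕ → E)} (hB : MeasurableSet[obsFiltration E n] B) :
    changeMeasure f₀ f₁ k B = ∫⁻ ω in B, lrProd f₀ f₁ k n ω ∂changeMeasure f₀ f₁ ⊤ := by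
  have hB' := (obsFiltration E).le n B hB
  have hw := law_withDensity_lr hac
  have : IsProbabilityMeasure (f₀.law.withDensity (lr f₀ f₁)) := by rw [hw]; infer_instance
  rw [← withDensity_apply _ hB', changeMeasure_top_eq]
  let R : ℕ → Measure E := fun i => if i ∈ Finset.Icc k n then f₁.law else f₀.law
  have hR : ∀ i, IsProbabilityMeasure (R i) := by
    intro i; simp only [R]; split_ifs <;> infer_instance
  have := infinitePi_withDensity_prod f₀.law (measurable_lr f₀ f₁) (Finset.Icc k n) R
    (fun i => by rw [hw])
  change _ = ((Measure.infinitePi fun _ : ℕ => f₀.law).withDensity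
    (fun ω => ∏ i ∈ Finset.Icc k n, lr f₀ f₁ (ω i))) B
  rw [this]
  refine infinitePi_congr_of_measurableSet_obsFiltration (fun i hi => ?_) hB
  have := (Finset.mem_Icc.1 hi).2
  by_cases hik : i < k
  · simp [R, hik]
  · simp [R, hik, this, not_lt.1 hik]

theorem changeMeasure_eq_top_of_lt {k n : ℕ} (hnk : n < k)
    {B : Set (ℕ → E)} (hB : MeasurableSet[obsFiltration E n] B) :
    changeMeasure f₀ f₁ k B = changeMeasure f₀ f₁ ⊤ B := by
  refine infinitePi_congr_of_measurableSet_obsFiltration (fun i hi => ?_) hB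
  have := (Finset.mem_Icc.1 hi).2
  simp [this.trans_lt hnk]

theorem changeMeasure_inter_lt_le (hac : f₁.law ≪ f₀.law) {k n : ℕ} (hk : 1 ≤ k)
    {B : Set (ℕ → E)} (hB : MeasurableSet[obsFiltration E n] B) (c : ℝ≥0∞) :
    changeMeasure f₀ f₁ k (B ∩ {ω | lrProd f₀ f₁ k n ω < c}) ≤ c * changeMeasure f₀ f₁ ⊤ B := by
  have hB2 : MeasurableSet[obsFiltration E n] (B ∩ {ω | lrProd f₀ f₁ k n ω < c}) :=
    MeasurableSet.inter hB (measurable_obsFiltration_lrProd f₀ f₁ hk n measurableSet_Iio)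
  rw [changeMeasure_apply_eq_setLIntegral hac hB2]
  calc _ ≤ ∫⁻ ω in B ∩ {ω | lrProd f₀ f₁ k n ω < c}, c ∂changeMeasure f₀ f₁ ⊤ :=
        setLIntegral_mono' ((obsFiltration E).le n _ hB2) fun ω hω => hω.2.le
    _ ≤ _ := by
        rw [setLIntegral_const]
        gcongr
        exact Set.inter_subset_left

/-- Seen from the change point, every `P_k` looks the same; hence the tail estimates under one
i.i.d. law are uniform in `k`. -/
theorem changeMeasure_map_shift (k : ℕ) :
    (changeMeasure f₀ f₁ k).map (fun ω i => ω (k + i)) =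
      Measure.infinitePi fun _ : ℕ => f₁.law := by
  rw [changeMeasure, Measure.map_infinitePi_infinitePi_of_inj (f := fun i => k + i)
    (add_right_injective k)]
  congr 1 with i : 1
  rw [if_neg (by simp)]

theorem lrProd_add (k n : ℕ) (ω : ℕ → E) :
    lrProd f₀ f₁ k (k + n) ω = ∏ i ∈ Finset.range (n + 1), lr f₀ f₁ (ω (k + i)) := by
  rw [lrProd, ← Finset.Ico_add_one_right_eq_Icc, Finset.prod_Ico_eq_prod_range]
  congr 2
  omega

theorem avgLR_eq (π : PMF ℕ) (n : ℕ) (ω : ℕ → E) :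
    avgLR f₀ f₁ π n ω = ∑' k : ℕ, π k * lrProd f₀ f₁ k n ω := rfl

theorem measurable_obsFiltration_avgLR (f₀ f₁ : ProbDensity μ) {π : PMF ℕ} (hπ : π 0 = 0)
    (n : ℕ) : Measurable[obsFiltration E n] (avgLR f₀ f₁ π n) := by
  have tsum {Ω : Type _} [MeasurableSpace Ω] {g : ℕ → Ω → ℝ≥0∞} (hg : ∀ k, Measurable (g k)) :
      Measurable fun ω => ∑' k, g k ω := Measurable.tsum hg
  refine @tsum (ℕ → E) (obsFiltration E n) _ fun k => ?_
  rcases Nat.eq_zero_or_pos k with rfl | hk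
  -- The term `k = 0` would involve `X_0`, which is not observed; the prior removes it.
  · simp [hπ]
  · exact Measurable.const_mul (measurable_obsFiltration_lrProd f₀ f₁ hk n) (π k)

theorem tsum_changeMeasure_eq_setLIntegral_avgLR (hac : f₁.law ≪ f₀.law) (π : PMF ℕ) {n : ℕ}
    {B : Set (ℕ → E)} (hB : MeasurableSet[obsFiltration E n] B) :
    ∑' k : ℕ, π k * changeMeasure f₀ f₁ k B =
      ∫⁻ ω in B, avgLR f₀ f₁ π n ω ∂changeMeasure f₀ f₁ ⊤ := by
  simp_rw [avgLR_eq]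
  rw [lintegral_tsum fun k => ((measurable_lrProd f₀ f₁ k n).const_mul _).aemeasurable]
  refine tsum_congr fun k => ?_
  rw [lintegral_const_mul _ (measurable_lrProd f₀ f₁ k n),
    changeMeasure_apply_eq_setLIntegral hac hB]

end LikelihoodRatio

/-! ### False alarm probability and the probability of `τ ≥ λ`. -/

section FalseAlarm

variable {E : Type*} [MeasurableSpace E] {μ : Measure E} {f₀ f₁ : ProbDensity μ}

theorem isStoppingTime_tauA (f₀ f₁ : ProbDensity μ) {π : PMF ℕ} (hπ : π 0 = 0) (A : ℝ) :
    IsStoppingTime (obsFiltration E) (tauA f₀ f₁ π A) :=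
  Adapted.isStoppingTime_hittingAfter (measurable_obsFiltration_avgLR f₀ f₁ hπ) measurableSet_Ici

theorem measure_lt_top_eq_tsum (P : Measure (ℕ → E)) {τ : (ℕ → E) → ℕ∞}
    (hτ : IsStoppingTime (obsFiltration E) τ) :
    P {ω | τ ω < ⊤} = ∑' n : ℕ, P {ω | τ ω = n} := by
  rw [← measure_iUnion]
  · congr 1 with ω
    simp [lt_top_iff_ne_top, ENat.ne_top_iff_exists, eq_comm]
  · intro i j hij
    refine Set.disjoint_left.2 fun ω hi hj => hij ?_
    simp only [Set.mem_ofPred_eq] at hi hj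
    exact_mod_cast hi.symm.trans hj
  · exact fun n => (obsFiltration E).le n _ (hτ.measurableSet_eq n)

theorem le_avgLR_of_tauA_eq {π : PMF ℕ} {A : ℝ} {n : ℕ} {ω : ℕ → E}
    (h : tauA f₀ f₁ π A ω = n) : ENNReal.ofReal A ≤ avgLR f₀ f₁ π n ω := by
  have h1 : tauA f₀ f₁ π A ω ≠ ⊤ := by simp [h]
  have := hittingAfter_mem_set_of_ne_top (u := avgLR f₀ f₁ π) (n := 1) (ω := ω) h1
  change avgLR f₀ f₁ π (WithTop.untopA (tauA f₀ f₁ π A ω)) ω ∈ _ at this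
  rw [h] at this
  exact this

/-- `G_n` is the density of the mixture `∑ π_k P_k` with respect to `P_∞` on `ℱ_n`, and `G_n ≥ A` on
`{τ_A = n}`. Summing over `n` bounds `A · P_∞(τ_A < ∞)` by a mixture probability. -/
theorem changeMeasure_top_tauA_lt_top_le (hac : f₁.law ≪ f₀.law) {π : PMF ℕ} (hπ : π 0 = 0)
    {A : ℝ} (hA : 0 < A) :
    changeMeasure f₀ f₁ ⊤ {ω | tauA f₀ f₁ π A ω < ⊤} ≤ ENNReal.ofReal (1 / A) := by
  have hτ := isStoppingTime_tauA f₀ f₁ hπ A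
  have key : ENNReal.ofReal A * changeMeasure f₀ f₁ ⊤ {ω | tauA f₀ f₁ π A ω < ⊤} ≤ 1 := by
    calc _ = ∑' n : ℕ, ENNReal.ofReal A * changeMeasure f₀ f₁ ⊤ {ω | tauA f₀ f₁ π A ω = n} := by
          rw [measure_lt_top_eq_tsum _ hτ, ENNReal.tsum_mul_left]
      _ ≤ ∑' n : ℕ, ∑' k : ℕ, π k * changeMeasure f₀ f₁ k {ω | tauA f₀ f₁ π A ω = n} := by
          refine ENNReal.tsum_le_tsum fun n => ?_
          have hm : MeasurableSet[obsFiltration E n] {ω | tauA f₀ f₁ π A ω = (n : ℕ∞)} :=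
            hτ.measurableSet_eq n
          rw [tsum_changeMeasure_eq_setLIntegral_avgLR hac π hm, ← setLIntegral_const]
          exact setLIntegral_mono' ((obsFiltration E).le n _ hm) fun ω hω => le_avgLR_of_tauA_eq hω
      _ = ∑' k : ℕ, π k * changeMeasure f₀ f₁ k {ω | tauA f₀ f₁ π A ω < ⊤} := by
          rw [ENNReal.tsum_comm]
          refine tsum_congr fun k => ?_
          rw [ENNReal.tsum_mul_left, measure_lt_top_eq_tsum _ hτ]
      _ ≤ ∑' k : ℕ, π k * 1 := by gcongr; exact prob_le_one
      _ = 1 := by simp [π.tsum_coe]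
  rw [one_div, ENNReal.ofReal_inv_of_pos hA, ENNReal.le_inv_iff_mul_le, mul_comm]
  exact key

theorem tauA_mem_falseAlarmClass (hac : f₁.law ≪ f₀.law) {π : PMF ℕ} (hπ : π 0 = 0)
    {A : ℝ} (hA : 0 < A) : tauA f₀ f₁ π A ∈ falseAlarmClass f₀ f₁ (1 / A) :=
  ⟨isStoppingTime_tauA f₀ f₁ hπ A, changeMeasure_top_tauA_lt_top_le hac hπ hA⟩

theorem lrProd_lt_of_lt_tauA {π : PMF ℕ} {A : ℝ} {k n : ℕ} (hk : 1 ≤ k) (hπk : π k ≠ 0)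
    {ω : ℕ → E} (h : ((k + n : ℕ) : ℕ∞) < tauA f₀ f₁ π A ω) :
    lrProd f₀ f₁ k (k + n) ω < ENNReal.ofReal A / π k := by
  have h1 := notMem_of_lt_hittingAfter (u := avgLR f₀ f₁ π) (k := k + n) h (by omega)
  rw [Set.mem_Ici, not_le, avgLR_eq] at h1
  rw [ENNReal.lt_div_iff_mul_lt (.inl hπk) (.inl (π.apply_ne_top k)), mul_comm]
  exact (ENNReal.le_tsum k).trans_lt h1

/-- The event `τ < k` is decided by time `k - 1`, before the change, so `P_k` gives it the same mass
as `P_∞`, at most `α`. -/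
theorem ofReal_one_sub_le_tsum {τ : (ℕ → E) → ℕ∞} {π : PMF ℕ} (hπ : π 0 = 0) {α : ℝ}
    (hα : 0 ≤ α) (hτ : τ ∈ falseAlarmClass f₀ f₁ α) :
    ENNReal.ofReal (1 - α) ≤ ∑' k : ℕ, π k * changeMeasure f₀ f₁ k {ω | (k : ℕ∞) ≤ τ ω} := by
  have h1 : ∑' k : ℕ, π k * ENNReal.ofReal (1 - α) = ENNReal.ofReal (1 - α) := by
    rw [ENNReal.tsum_mul_right, π.tsum_coe, one_mul]
  rw [← h1]
  refine ENNReal.tsum_le_tsum fun k => ?_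
  rcases Nat.eq_zero_or_pos k with rfl | hk
  · simp [hπ]
  gcongr
  have hset : {ω | (k : ℕ∞) ≤ τ ω} = {ω | τ ω ≤ (k - 1 : ℕ)}ᶜ := by
    ext ω
    simp only [Set.mem_ofPred_eq, Set.mem_compl_iff, not_le]
    rcases eq_or_ne (τ ω) ⊤ with h | h
    · simp only [h, le_top, true_iff]
      exact ENat.natCast_lt_top _
    · lift τ ω to ℕ using h with x
      norm_cast
      omega
  have hm : MeasurableSet[obsFiltration E (k - 1)] {ω | τ ω ≤ ((k - 1 : ℕ) : ℕ∞)} := hτ.1 (k - 1)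
  rw [hset, prob_compl_eq_one_sub ((obsFiltration E).le _ _ hm),
    changeMeasure_eq_top_of_lt (by omega : k - 1 < k) hm, ENNReal.ofReal_sub _ hα,
    ENNReal.ofReal_one]
  gcongr
  refine le_trans (measure_mono fun ω hω => ?_) hτ.2
  exact lt_of_le_of_lt hω (ENat.natCast_lt_top _)

theorem tsum_changeMeasure_le_one (π : PMF ℕ) (B : ℕ → Set (ℕ → E)) :
    ∑' k : ℕ, π k * changeMeasure f₀ f₁ k (B k) ≤ 1 := by
  calc _ ≤ ∑' k : ℕ, π k * 1 := by gcongr; exact prob_le_one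
    _ = 1 := by simp [π.tsum_coe]

end FalseAlarm

/-! ### The log-likelihood random walk: Chernoff bound and strong law. -/

section LogLikelihoodRatio

variable {E : Type*} [MeasurableSpace E] {μ : Measure E} {f₀ f₁ : ProbDensity μ}

/-- The log-likelihood ratio `log (f₁ / f₀)` of a single observation. -/
noncomputable def logLR (f₀ f₁ : ProbDensity μ) (x : E) : ℝ := Real.log (lr f₀ f₁ x).toReal

@[fun_prop]
theorem measurable_logLR (f₀ f₁ : ProbDensity μ) : Measurable (logLR f₀ f₁) :=
  Real.measurable_log.comp (measurable_lr f₀ f₁).ennreal_toReal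

theorem logLR_ae_eq_llr (hac : f₁.law ≪ f₀.law) :
    logLR f₀ f₁ =ᵐ[f₁.law] llr f₁.law f₀.law := by
  have := Measure.rnDeriv_withDensity f₀.law (measurable_lr f₀ f₁)
  rw [law_withDensity_lr hac] at this
  filter_upwards [hac.ae_le this] with x hx
  rw [logLR, llr, hx]

theorem integrable_logLR (hI : klNumber f₁ f₀ ≠ ∞) : Integrable (logLR f₀ f₁) f₁.law := by
  obtain ⟨hac, hint⟩ := InformationTheory.klDiv_ne_top_iff.1 hI
  exact (integrable_congr (logLR_ae_eq_llr hac)).2 hint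

theorem integral_logLR (hI : klNumber f₁ f₀ ≠ ∞) :
    ∫ x, logLR f₀ f₁ x ∂f₁.law = (klNumber f₁ f₀).toReal := by
  obtain ⟨hac, hint⟩ := InformationTheory.klDiv_ne_top_iff.1 hI
  rw [klNumber, InformationTheory.toReal_klDiv_of_measure_eq hac (by simp),
    integral_congr_ae (logLR_ae_eq_llr hac)]

theorem ae_lr_eq_ofReal_exp (hac : f₁.law ≪ f₀.law) :
    ∀ᵐ x ∂f₁.law, lr f₀ f₁ x = ENNReal.ofReal (Real.exp (logLR f₀ f₁ x)) := by
  filter_upwards [ae_lr_ne_zero_and_ne_top hac] with x hx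
  rw [logLR, Real.exp_log (ENNReal.toReal_pos hx.1 hx.2), ENNReal.ofReal_toReal hx.2]

/-- Changing measure back to `f₀` turns the integrand into `lr · lr⁻¹ ≤ 1`. The lower tail of `Z` is
therefore always exponentially small. -/
theorem integrable_exp_neg_logLR (hac : f₁.law ≪ f₀.law) :
    Integrable (fun x => Real.exp (-logLR f₀ f₁ x)) f₁.law := by
  refine ⟨by fun_prop, ?_⟩
  rw [hasFiniteIntegral_iff_ofReal (ae_of_all _ fun x => (Real.exp_pos _).le)]
  calc ∫⁻ x, ENNReal.ofReal (Real.exp (-logLR f₀ f₁ x)) ∂f₁.law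
      = ∫⁻ x, (lr f₀ f₁ x)⁻¹ ∂f₁.law := by
        refine lintegral_congr_ae ?_
        filter_upwards [ae_lr_eq_ofReal_exp hac] with x hx
        rw [hx, Real.exp_neg, ENNReal.ofReal_inv_of_pos (Real.exp_pos _)]
    _ = ∫⁻ x, lr f₀ f₁ x * (lr f₀ f₁ x)⁻¹ ∂f₀.law := by
        conv_lhs => rw [← law_withDensity_lr hac]
        rw [lintegral_withDensity_eq_lintegral_mul _ (measurable_lr f₀ f₁)
          (g := fun x => (lr f₀ f₁ x)⁻¹) (measurable_lr f₀ f₁).inv]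
        rfl
    _ ≤ ∫⁻ x, 1 ∂f₀.law := lintegral_mono fun x => ENNReal.mul_inv_le_one _
    _ < ∞ := by simp

/-- A dominating function free of `t`: one side is `1 + u ≤ exp u`, the other is convexity of `exp`
between `-z` and `0`. -/
theorem abs_one_sub_exp_neg_mul_div_le {t : ℝ} (ht : 0 < t) (ht1 : t ≤ 1) (z : ℝ) :
    |(1 - Real.exp (-(t * z))) / t| ≤ |z| + Real.exp (-z) := by
  have h1 : 1 - Real.exp (-(t * z)) ≤ t * |z| := by
    have := Real.add_one_le_exp (-(t * z))
    have := mul_le_mul_of_nonneg_left (le_abs_self z) ht.le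
    linarith
  have h2 : Real.exp (-(t * z)) ≤ t * Real.exp (-z) + (1 - t) := by
    have := convexOn_exp.2 (Set.mem_univ (-z)) (Set.mem_univ 0) ht.le (sub_nonneg.2 ht1) (by ring)
    simpa using this
  rw [abs_le, le_div_iff₀ ht, div_le_iff₀ ht]
  have h3 : 0 ≤ t * |z| := by positivity
  have h4 : 0 ≤ t * Real.exp (-z) := by positivity
  constructor <;> nlinarith

/-- As `t ↓ 0`, `(1 - E₁ exp(-tZ))/t` tends to `E₁ Z = I > J` by dominated convergence. For some
small `t` this gives `E₁ exp(-tZ) ≤ 1 - tJ ≤ exp(-tJ)`. -/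
theorem exists_lintegral_exp_neg_mul_logLR_le (hI : klNumber f₁ f₀ ≠ ∞) {J : ℝ}
    (hJ : J < (klNumber f₁ f₀).toReal) :
    ∃ t > 0, ∫⁻ x, ENNReal.ofReal (Real.exp (-(t * logLR f₀ f₁ x))) ∂f₁.law ≤
      ENNReal.ofReal (Real.exp (-(t * J))) := by
  have hac := (InformationTheory.klDiv_ne_top_iff.1 hI).1
  set F : ℝ → E → ℝ := fun t x => (1 - Real.exp (-(t * logLR f₀ f₁ x))) / t
  have hIoc : ∀ᶠ t in 𝓝[>] (0 : ℝ), t ∈ Set.Ioc (0 : ℝ) 1 :=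
    Ioc_mem_nhdsGT one_pos
  have hbi : Integrable (fun x => |logLR f₀ f₁ x| + Real.exp (-logLR f₀ f₁ x)) f₁.law :=
    (integrable_logLR hI).abs.add (integrable_exp_neg_logLR hac)
  have hFm : ∀ t, AEStronglyMeasurable (F t) f₁.law := fun t => by
    have : Measurable (F t) := by fun_prop
    exact this.aestronglyMeasurable
  have hlim : Tendsto (fun t => ∫ x, F t x ∂f₁.law) (𝓝[>] 0) (𝓝 (∫ x, logLR f₀ f₁ x ∂f₁.law)) := by
    refine tendsto_integral_filter_of_dominated_convergence _ (.of_forall hFm) ?_ hbi ?_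
    · filter_upwards [hIoc] with t ht
      exact ae_of_all _ fun x => abs_one_sub_exp_neg_mul_div_le ht.1 ht.2 _
    · refine ae_of_all _ fun x => ?_
      set z := logLR f₀ f₁ x with hz
      have hd : HasDerivAt (fun t : ℝ => -Real.exp (-(t * z))) z 0 := by
        have h := (hasDerivAt_mul_const (x := (0 : ℝ)) z).fun_neg.exp.fun_neg
        rwa [zero_mul, neg_zero, Real.exp_zero, one_mul, neg_neg] at h
      refine hd.tendsto_slope_zero_right.congr fun t => ?_
      simp only [F, zero_add, zero_mul, neg_zero, Real.exp_zero, smul_eq_mul, ← hz]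
      rw [div_eq_inv_mul]
      ring
  rw [integral_logLR hI] at hlim
  obtain ⟨t, ht, htJ⟩ := (hIoc.and (hlim.eventually (lt_mem_nhds hJ))).exists
  have hFi : Integrable (F t) f₁.law := hbi.mono' (hFm t)
    (ae_of_all _ fun x => abs_one_sub_exp_neg_mul_div_le ht.1 ht.2 _)
  have hexp : (fun x => Real.exp (-(t * logLR f₀ f₁ x))) = fun x => 1 - t * F t x := by
    funext x
    have := ht.1.ne'
    simp only [F]
    field_simp
    ring
  have hi : Integrable (fun x => Real.exp (-(t * logLR f₀ f₁ x))) f₁.law := by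
    rw [hexp]
    exact (integrable_const _).sub (hFi.const_mul t)
  refine ⟨t, ht.1, ?_⟩
  rw [← ofReal_integral_eq_lintegral_ofReal hi (ae_of_all _ fun x => (Real.exp_pos _).le)]
  refine ENNReal.ofReal_le_ofReal ?_
  rw [hexp, integral_sub (integrable_const _) (hFi.const_mul t), integral_const_mul]
  have h1 := Real.add_one_le_exp (-(t * J))
  have h2 := mul_le_mul_of_nonneg_left htJ.le ht.1.le
  simp
  linarith

theorem ae_prod_lr_eq (hac : f₁.law ≪ f₀.law) :
    ∀ᵐ ω ∂Measure.infinitePi fun _ : ℕ => f₁.law, ∀ n : ℕ,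
      ∏ i ∈ Finset.range n, lr f₀ f₁ (ω i) =
        ENNReal.ofReal (Real.exp (∑ i ∈ Finset.range n, logLR f₀ f₁ (ω i))) := by
  have h : ∀ᵐ ω ∂Measure.infinitePi fun _ : ℕ => f₁.law, ∀ i : ℕ,
      lr f₀ f₁ (ω i) = ENNReal.ofReal (Real.exp (logLR f₀ f₁ (ω i))) := by
    rw [ae_all_iff]
    exact fun i => (measurePreserving_eval_infinitePi (fun _ : ℕ => f₁.law) i).quasiMeasurePreserving.ae
      (ae_lr_eq_ofReal_exp hac)
  filter_upwards [h] with ω hω n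
  rw [Real.exp_sum, ENNReal.ofReal_prod_of_nonneg fun i _ => (Real.exp_pos _).le]
  exact Finset.prod_congr rfl fun i _ => hω i

/-- Markov's inequality for `exp(-t(Z_0 + … + Z_{n-1}))`. -/
theorem infinitePi_prod_lr_lt_le (hac : f₁.law ≪ f₀.law) {t J : ℝ} (ht : 0 < t)
    (htJ : ∫⁻ x, ENNReal.ofReal (Real.exp (-(t * logLR f₀ f₁ x))) ∂f₁.law ≤
      ENNReal.ofReal (Real.exp (-(t * J)))) (a : ℝ) (n : ℕ) :
    (Measure.infinitePi fun _ : ℕ => f₁.law)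
        {ω | ∏ i ∈ Finset.range n, lr f₀ f₁ (ω i) < ENNReal.ofReal (Real.exp a)} ≤
      ENNReal.ofReal (Real.exp (t * (a - n * J))) := by
  set Q := Measure.infinitePi fun _ : ℕ => f₁.law
  set g : E → ℝ≥0∞ := fun x => ENNReal.ofReal (Real.exp (-(t * logLR f₀ f₁ x)))
  have hg : Measurable g := by fun_prop
  have h1 : Q {ω | ∏ i ∈ Finset.range n, lr f₀ f₁ (ω i) < ENNReal.ofReal (Real.exp a)} ≤
      Q {ω | ENNReal.ofReal (Real.exp (-(t * a))) ≤ ∏ i ∈ Finset.range n, g (ω i)} := by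
    refine measure_mono_ae ?_
    filter_upwards [ae_prod_lr_eq hac] with ω hω h
    change ∏ i ∈ Finset.range n, lr f₀ f₁ (ω i) < ENNReal.ofReal (Real.exp a) at h
    rw [hω, ENNReal.ofReal_lt_ofReal_iff (Real.exp_pos _), Real.exp_lt_exp] at h
    change ENNReal.ofReal (Real.exp (-(t * a))) ≤ ∏ i ∈ Finset.range n, g (ω i)
    rw [← ENNReal.ofReal_prod_of_nonneg fun i _ => (Real.exp_pos _).le, ← Real.exp_sum]
    refine ENNReal.ofReal_le_ofReal (Real.exp_le_exp.2 ?_)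
    rw [Finset.sum_neg_distrib, ← Finset.mul_sum]
    have := mul_le_mul_of_nonneg_left h.le ht.le
    linarith
  have h2 : ∫⁻ ω, ∏ i ∈ Finset.range n, g (ω i) ∂Q = (∫⁻ x, g x ∂f₁.law) ^ n := by
    rw [show ∫⁻ ω, ∏ i ∈ Finset.range n, g (ω i) ∂Q = ∏ i ∈ Finset.range n, ∫⁻ ω, g (ω i) ∂Q from
      lintegral_prod_eq_prod_lintegral_of_indepFun _ (fun i (ω : ℕ → E) => g (ω i))
        (iIndepFun_infinitePi fun _ => hg) fun i => hg.comp (measurable_pi_apply i)]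
    have : ∀ i : ℕ, ∫⁻ ω, g (ω i) ∂Q = ∫⁻ x, g x ∂f₁.law := fun i =>
      (measurePreserving_eval_infinitePi (fun _ : ℕ => f₁.law) i).lintegral_comp hg
    simp [this]
  have h3 := meas_ge_le_lintegral_div (μ := Q) (f := fun ω => ∏ i ∈ Finset.range n, g (ω i))
    (Finset.measurable_prod _ fun i _ => hg.comp (measurable_pi_apply i)).aemeasurable
    (ε := ENNReal.ofReal (Real.exp (-(t * a)))) (by simp [Real.exp_pos]) ENNReal.ofReal_ne_top
  refine h1.trans (h3.trans ?_)
  rw [h2]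
  refine ENNReal.div_le_of_le_mul ?_
  calc (∫⁻ x, g x ∂f₁.law) ^ n ≤ ENNReal.ofReal (Real.exp (-(t * J))) ^ n := by gcongr
    _ = _ := by
      rw [← ENNReal.ofReal_pow (Real.exp_pos _).le, ← ENNReal.ofReal_mul (Real.exp_pos _).le,
        ← Real.exp_nat_mul, ← Real.exp_add]
      congr 2
      ring

/-- The events decrease in `C`, so the limit is the mass of their intersection, on which the walk
minus `Jn` is unbounded above. By the strong law this drift is eventually negative, so the
intersection is null. -/
theorem tendsto_infinitePi_exists_le_prod_lr (hI : klNumber f₁ f₀ ≠ ∞) {J : ℝ}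
    (hJ : (klNumber f₁ f₀).toReal < J) :
    Tendsto (fun C : ℝ => (Measure.infinitePi fun _ : ℕ => f₁.law)
      {ω | ∃ n : ℕ, ENNReal.ofReal (Real.exp (C + J * n)) ≤ ∏ i ∈ Finset.range n, lr f₀ f₁ (ω i)})
      atTop (𝓝 0) := by
  have hac := (InformationTheory.klDiv_ne_top_iff.1 hI).1
  set Q := Measure.infinitePi fun _ : ℕ => f₁.law
  set S : ℝ → Set (ℕ → E) := fun C =>
    {ω | ∃ n : ℕ, ENNReal.ofReal (Real.exp (C + J * n)) ≤ ∏ i ∈ Finset.range n, lr f₀ f₁ (ω i)}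
  have hSm : ∀ C, MeasurableSet (S C) := fun C => by
    simp only [S, Set.ofPred_exists]
    exact .iUnion fun n => measurableSet_le measurable_const
      (Finset.measurable_prod _ fun i _ => (measurable_lr f₀ f₁).comp (measurable_pi_apply i))
  have hanti : Antitone S := by
    rintro C C' hC ω ⟨n, hn⟩
    refine ⟨n, le_trans ?_ hn⟩
    gcongr
  have hlim := tendsto_measure_iInter_atTop (μ := Q) (fun C => (hSm C).nullMeasurableSet) hanti
    ⟨0, measure_ne_top _ _⟩
  suffices h : Q (⋂ C, S C) = 0 by rwa [h] at hlim
  have heval : ∀ i : ℕ, MeasurePreserving (fun ω : ℕ → E => ω i) Q f₁.law :=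
    measurePreserving_eval_infinitePi (fun _ : ℕ => f₁.law)
  have hslln := strong_law_ae_real (μ := Q) (fun i (ω : ℕ → E) => logLR f₀ f₁ (ω i))
    ((heval 0).integrable_comp_of_integrable (integrable_logLR hI))
    (fun i j hij => (iIndepFun_infinitePi (P := fun _ : ℕ => f₁.law)
      (X := fun _ => logLR f₀ f₁) fun _ => measurable_logLR f₀ f₁).indepFun hij)
    (fun i => ⟨((measurable_logLR f₀ f₁).comp (measurable_pi_apply i)).aemeasurable,
      ((measurable_logLR f₀ f₁).comp (measurable_pi_apply 0)).aemeasurable, by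
      have (i : ℕ) : Q.map (fun ω => logLR f₀ f₁ (ω i)) = f₁.law.map (logLR f₀ f₁) := by
        rw [← (heval i).map_eq, Measure.map_map (by fun_prop) (by fun_prop)]
        rfl
      rw [this, this]⟩)
  have hmean : ∫ ω, logLR f₀ f₁ (ω 0) ∂Q = (klNumber f₁ f₀).toReal := by
    rw [← integral_logLR hI, ← (heval 0).map_eq, integral_map (heval 0).aemeasurable
      (measurable_logLR f₀ f₁).aestronglyMeasurable]
  rw [hmean] at hslln
  rw [measure_eq_zero_iff_ae_notMem]
  filter_upwards [hslln, ae_prod_lr_eq hac] with ω h1 h2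
  have hb : BddAbove (Set.range fun n : ℕ => ∑ i ∈ Finset.range n, logLR f₀ f₁ (ω i) - J * n) := by
    refine IsBoundedUnder.bddAbove_range ⟨0, ?_⟩
    rw [eventually_map]
    filter_upwards [h1.eventually (gt_mem_nhds hJ), eventually_gt_atTop 0] with n hn hn0
    rw [div_lt_iff₀ (by exact_mod_cast hn0)] at hn
    linarith
  obtain ⟨C, hC⟩ := hb
  simp only [Set.mem_iInter, not_forall]
  refine ⟨C + 1, ?_⟩
  rintro ⟨n, hn⟩
  rw [h2, ENNReal.ofReal_le_ofReal_iff (Real.exp_pos _).le, Real.exp_le_exp] at hn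
  have := hC ⟨n, rfl⟩
  simp only at this
  linarith

end LogLikelihoodRatio

/-! ### Elementary moment inequalities. -/

/-- Either `y ≤ e x` or `x ≤ e⁻¹ y`, with `(1 + e)^m = η`. The leading term keeps a factor as near
`1` as desired, for every `m > 0`. -/
theorem exists_add_rpow_le {m η : ℝ} (hm : 0 < m) (hη : 1 < η) :
    ∃ K : ℝ≥0∞, K ≠ ∞ ∧ ∀ x y : ℝ≥0∞, (x + y) ^ m ≤ ENNReal.ofReal η * x ^ m + K * y ^ m := by
  set c := η ^ (1 / m) with hc
  have hc1 : 1 < c := Real.one_lt_rpow hη (by positivity)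
  set e := ENNReal.ofReal (c - 1) with he
  have he0 : e ≠ 0 := by simpa [he] using hc1
  have het : e ≠ ∞ := ENNReal.ofReal_ne_top
  have hce : (1 + e) ^ m = ENNReal.ofReal η := by
    rw [he, ← ENNReal.ofReal_one, ← ENNReal.ofReal_add zero_le_one (by linarith),
      ENNReal.ofReal_rpow_of_nonneg (by linarith) hm.le, add_sub_cancel, hc,
      ← Real.rpow_mul (by linarith), one_div_mul_cancel hm.ne', Real.rpow_one]
  refine ⟨(e⁻¹ + 1) ^ m, ?_, fun x y => ?_⟩
  · exact ENNReal.rpow_ne_top_of_nonneg hm.le (by simp [he0])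
  rcases le_total y (e * x) with h | h
  · calc (x + y) ^ m ≤ ((1 + e) * x) ^ m := by
          gcongr
          rw [add_mul, one_mul]
          gcongr
      _ = ENNReal.ofReal η * x ^ m := by rw [ENNReal.mul_rpow_of_nonneg _ _ hm.le, hce]
      _ ≤ _ := le_self_add
  · calc (x + y) ^ m ≤ ((e⁻¹ + 1) * y) ^ m := by
          gcongr
          rw [add_mul, one_mul]
          gcongr
          exact (ENNReal.mul_le_iff_le_inv he0 het).1 h
      _ = (e⁻¹ + 1) ^ m * y ^ m := by rw [ENNReal.mul_rpow_of_nonneg _ _ hm.le]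
      _ ≤ _ := le_add_self

/-- For finite `T > M` the single term `j = T - M - 1` suffices. The crude bound is harmless because
the tails are exponential. -/
theorem sub_rpow_le_tsum {m : ℝ} (hm : 0 < m) (T : ℕ∞) (M : ℕ) :
    ((T : ℝ≥0∞) - (M : ℝ≥0∞)) ^ m ≤
      ∑' j : ℕ, if ((M + j : ℕ) : ℕ∞) < T then ((j + 1 : ℕ) : ℝ≥0∞) ^ m else 0 := by
  induction T using ENat.recTopCoe with
  | top =>
    have h : ∑' j : ℕ, (1 : ℝ≥0∞) ≤
        ∑' j : ℕ, if ((M + j : ℕ) : ℕ∞) < ⊤ then ((j + 1 : ℕ) : ℝ≥0∞) ^ m else 0 := by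
      refine ENNReal.tsum_le_tsum fun j => ?_
      rw [if_pos (ENat.natCast_lt_top _)]
      exact ENNReal.one_le_rpow (by exact_mod_cast Nat.le_add_left 1 j) hm
    rw [ENNReal.tsum_const_eq_top_of_ne_zero one_ne_zero] at h
    exact le_top.trans h
  | coe n =>
    rcases le_or_gt n M with h | h
    · have : ((n : ℕ∞) : ℝ≥0∞) - (M : ℝ≥0∞) = 0 :=
        tsub_eq_zero_of_le (by exact_mod_cast h)
      rw [this, ENNReal.zero_rpow_of_pos hm]
      exact zero_le
    · refine le_trans ?_ (ENNReal.le_tsum (n - M - 1))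
      rw [if_pos (by norm_cast; omega)]
      refine ENNReal.rpow_le_rpow ?_ hm.le
      rw [tsub_le_iff_right]
      norm_cast
      omega

theorem tsum_rpow_mul_exp_ne_top (m : ℝ) {r : ℝ} (hr : 0 < r) :
    ∑' j : ℕ, ((j + 1 : ℕ) : ℝ≥0∞) ^ m * ENNReal.ofReal (Real.exp (-(r * j))) ≠ ∞ := by
  obtain ⟨p, hp⟩ := exists_nat_ge m
  have h1 : Summable fun j : ℕ => ((j + 1 : ℕ) : ℝ) ^ p * Real.exp (-(r * j)) := by
    have h := ((summable_nat_add_iff 1).2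
      (Real.summable_pow_mul_exp_neg_nat_mul p hr)).mul_right (Real.exp r)
    refine h.congr fun j => ?_
    rw [mul_assoc, ← Real.exp_add]
    congr 2
    push_cast
    ring
  refine ne_top_of_le_ne_top h1.tsum_ofReal_ne_top (ENNReal.tsum_le_tsum fun j => ?_)
  rw [ENNReal.ofReal_mul (by positivity), ENNReal.ofReal_pow (by positivity),
    ENNReal.ofReal_natCast]
  gcongr
  rw [← ENNReal.rpow_natCast]
  exact ENNReal.rpow_le_rpow_of_exponent_le (by exact_mod_cast Nat.le_add_left 1 j) hp

/-! ### Upper bound for the delay of `τ_A`. -/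

section UpperBound

variable {E : Type*} [MeasurableSpace E] {μ : Measure E} {f₀ f₁ : ProbDensity μ}

theorem changeMeasure_lt_tauA_le (hac : f₁.law ≪ f₀.law) {t J : ℝ} (ht : 0 < t)
    (htJ : ∫⁻ x, ENNReal.ofReal (Real.exp (-(t * logLR f₀ f₁ x))) ∂f₁.law ≤
      ENNReal.ofReal (Real.exp (-(t * J)))) {π : PMF ℕ} {A : ℝ} (hA : 0 < A) {k : ℕ} (hk : 1 ≤ k)
    (hπk : π k ≠ 0) (n : ℕ) :
    changeMeasure f₀ f₁ k {ω | ((k + n : ℕ) : ℕ∞) < tauA f₀ f₁ π A ω} ≤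
      ENNReal.ofReal (Real.exp
        (t * (Real.log A + |Real.log (π k).toReal| - (n + 1 : ℕ) * J))) := by
  refine le_trans ?_ (infinitePi_prod_lr_lt_le hac ht htJ _ (n + 1))
  have hp : 0 < (π k).toReal := ENNReal.toReal_pos hπk (π.apply_ne_top k)
  have hp1 : (π k).toReal ≤ 1 := ENNReal.toReal_le_of_le_ofReal zero_le_one
    (by simpa using π.coe_le_one k)
  have hc : ENNReal.ofReal A / π k =
      ENNReal.ofReal (Real.exp (Real.log A + |Real.log (π k).toReal|)) := by
    rw [abs_of_nonpos (Real.log_nonpos hp.le hp1), Real.exp_add, Real.exp_log hA, Real.exp_neg,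
      Real.exp_log hp, ENNReal.ofReal_mul hA.le, ENNReal.ofReal_inv_of_pos hp,
      ENNReal.ofReal_toReal (π.apply_ne_top k), div_eq_mul_inv]
  rw [← changeMeasure_map_shift (f₀ := f₀) k, Measure.map_apply (by fun_prop)]
  · refine measure_mono fun ω hω => ?_
    have h := lrProd_lt_of_lt_tauA hk hπk hω
    rw [lrProd_add, hc] at h
    exact h
  · exact measurableSet_lt (Finset.measurable_prod _ fun i _ =>
      (measurable_lr f₀ f₁).comp (measurable_pi_apply i)) measurable_const

theorem lintegral_tauA_delay_le (hac : f₁.law ≪ f₀.law) {t J : ℝ} (ht : 0 < t) (hJ : 0 < J)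
    (htJ : ∫⁻ x, ENNReal.ofReal (Real.exp (-(t * logLR f₀ f₁ x))) ∂f₁.law ≤
      ENNReal.ofReal (Real.exp (-(t * J)))) {m : ℝ} (hm : 0 < m) {a K b K' : ℝ≥0∞}
    (hK : ∀ x y : ℝ≥0∞, (x + y) ^ m ≤ a * x ^ m + K * y ^ m)
    (hK' : ∀ x y : ℝ≥0∞, (x + y) ^ m ≤ b * x ^ m + K' * y ^ m)
    {π : PMF ℕ} (hπ : π 0 = 0) {A : ℝ} (hA : 1 < A) {k : ℕ} (hk : 1 ≤ k) (hπk : π k ≠ 0) :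
    ∫⁻ ω in {ω | (k : ℕ∞) ≤ tauA f₀ f₁ π A ω},
        ((tauA f₀ f₁ π A ω : ℝ≥0∞) - (k : ℝ≥0∞)) ^ m ∂changeMeasure f₀ f₁ k ≤
      a * ENNReal.ofReal (Real.log A / J) ^ m +
        K * (b * ENNReal.ofReal (|Real.log (π k).toReal| / J + 1) ^ m +
          K' * ∑' j : ℕ, ((j + 1 : ℕ) : ℝ≥0∞) ^ m * ENNReal.ofReal (Real.exp (-(t * J * j)))) := by
  set τ := tauA f₀ f₁ π A with hτ_def
  have hτ := isStoppingTime_tauA f₀ f₁ hπ A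
  set l := Real.log A with hl
  have hl0 : 0 < l := Real.log_pos hA
  set p := |Real.log (π k).toReal|
  have hp0 : 0 ≤ p := abs_nonneg _
  -- After `M` steps the drift `J` has paid for the level `log A + |log π_k|`, so the Chernoff bound
  -- at `k + M + j` is at most `exp(-tJj)`.
  set M := ⌈(l + p) / J⌉₊
  have hM1 : l + p ≤ M * J := (div_le_iff₀ hJ).1 (Nat.le_ceil _)
  have hM2 : (M : ℝ≥0∞) ≤ ENNReal.ofReal (l / J) + ENNReal.ofReal (p / J + 1) := by
    rw [← ENNReal.ofReal_add (by positivity) (by positivity), ← ENNReal.ofReal_natCast]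
    refine ENNReal.ofReal_le_ofReal ?_
    have := (Nat.ceil_lt_add_one (by positivity : 0 ≤ (l + p) / J)).le
    have h := add_div l p J
    linarith
  let V : (ℕ → E) → ℝ≥0∞ := fun ω =>
    ∑' j : ℕ, {ω | ((k + M + j : ℕ) : ℕ∞) < τ ω}.indicator (fun _ => ((j + 1 : ℕ) : ℝ≥0∞) ^ m) ω
  have hmeas : ∀ n : ℕ, MeasurableSet {ω | (n : ℕ∞) < τ ω} := fun n => by
    have h : MeasurableSet {ω | τ ω ≤ (n : ℕ∞)} := (obsFiltration E).le n _ (hτ n)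
    convert h.compl using 1
    ext ω
    simp
  have hVm : Measurable V := Measurable.tsum fun j => measurable_const.indicator (hmeas _)
  have hV : ∫⁻ ω, V ω ∂changeMeasure f₀ f₁ k ≤
      ∑' j : ℕ, ((j + 1 : ℕ) : ℝ≥0∞) ^ m * ENNReal.ofReal (Real.exp (-(t * J * j))) := by
    simp only [V]
    rw [lintegral_tsum fun j => (measurable_const.indicator (hmeas _)).aemeasurable]
    refine ENNReal.tsum_le_tsum fun j => ?_
    rw [lintegral_indicator (hmeas _), setLIntegral_const]
    gcongr
    rw [add_assoc]
    refine (changeMeasure_lt_tauA_le hac ht htJ (zero_lt_one.trans hA) hk hπk _).trans ?_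
    refine ENNReal.ofReal_le_ofReal (Real.exp_le_exp.2 ?_)
    rw [mul_assoc, ← mul_neg]
    refine mul_le_mul_of_nonneg_left ?_ ht.le
    push_cast
    linarith
  have hpt : ∀ ω, ((τ ω : ℝ≥0∞) - (k : ℝ≥0∞)) ^ m ≤ a * ENNReal.ofReal (l / J) ^ m +
        K * (b * ENNReal.ofReal (p / J + 1) ^ m + K' * V ω) := by
    intro ω
    have hW : ((τ ω : ℝ≥0∞) - ((k + M : ℕ) : ℝ≥0∞)) ^ m ≤ V ω := by
      refine (sub_rpow_le_tsum hm (τ ω) (k + M)).trans (le_of_eq (tsum_congr fun j => ?_))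
      simp [Set.indicator_apply]
    calc ((τ ω : ℝ≥0∞) - (k : ℝ≥0∞)) ^ m
        ≤ (ENNReal.ofReal (l / J) + (ENNReal.ofReal (p / J + 1) +
            ((τ ω : ℝ≥0∞) - ((k + M : ℕ) : ℝ≥0∞)))) ^ m := by
          refine ENNReal.rpow_le_rpow ?_ hm.le
          rw [← add_assoc, Nat.cast_add, ← tsub_tsub]
          exact le_add_tsub.trans (by gcongr)
      _ ≤ _ := by
          refine (hK _ _).trans ?_
          gcongr
          refine (hK' _ _).trans ?_
          gcongr
  calc _ ≤ ∫⁻ ω, ((τ ω : ℝ≥0∞) - (k : ℝ≥0∞)) ^ m ∂changeMeasure f₀ f₁ k :=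
        setLIntegral_le_lintegral _ _
    _ ≤ ∫⁻ ω, (a * ENNReal.ofReal (l / J) ^ m +
        K * (b * ENNReal.ofReal (p / J + 1) ^ m + K' * V ω)) ∂changeMeasure f₀ f₁ k :=
        lintegral_mono hpt
    _ = a * ENNReal.ofReal (l / J) ^ m +
        K * (b * ENNReal.ofReal (p / J + 1) ^ m +
          K' * ∫⁻ ω, V ω ∂changeMeasure f₀ f₁ k) := by
        rw [lintegral_add_left measurable_const, lintegral_const_mul K (by fun_prop),
          lintegral_add_left measurable_const, lintegral_const_mul _ hVm]
        simp
    _ ≤ _ := by gcongr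

theorem tsum_mul_ofReal_abs_log_rpow_ne_top {π : PMF ℕ} {m : ℝ} (hm : 0 < m)
    (hπ_sum : Summable fun k : ℕ => |Real.log (π k).toReal| ^ m * (π k).toReal) {J : ℝ}
    (hJ : 0 < J) :
    ∑' k : ℕ, π k * ENNReal.ofReal (|Real.log (π k).toReal| / J + 1) ^ m ≠ ∞ := by
  obtain ⟨K, hKt, hK⟩ := exists_add_rpow_le hm one_lt_two
  have h1 : ∀ k : ℕ, π k * ENNReal.ofReal (|Real.log (π k).toReal| / J) ^ m =
      ENNReal.ofReal ((J ^ m)⁻¹) *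
        ENNReal.ofReal (|Real.log (π k).toReal| ^ m * (π k).toReal) := by
    intro k
    rw [ENNReal.ofReal_rpow_of_nonneg (by positivity) hm.le, Real.div_rpow (abs_nonneg _) hJ.le,
      ← ENNReal.ofReal_mul (by positivity)]
    nth_rw 1 [← ENNReal.ofReal_toReal (π.apply_ne_top k)]
    rw [← ENNReal.ofReal_mul ENNReal.toReal_nonneg]
    congr 1
    ring
  have h2 : ∑' k : ℕ, π k * ENNReal.ofReal (|Real.log (π k).toReal| / J) ^ m ≠ ∞ := by
    simp_rw [h1]
    rw [ENNReal.tsum_mul_left]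
    exact ENNReal.mul_ne_top ENNReal.ofReal_ne_top hπ_sum.tsum_ofReal_ne_top
  have h3 : ∑' k : ℕ, (ENNReal.ofReal 2 * (π k * ENNReal.ofReal (|Real.log (π k).toReal| / J) ^ m) +
      K * π k) ≠ ∞ := by
    rw [ENNReal.tsum_add, ENNReal.tsum_mul_left, ENNReal.tsum_mul_left, π.tsum_coe, mul_one]
    exact ENNReal.add_ne_top.2 ⟨ENNReal.mul_ne_top ENNReal.ofReal_ne_top h2, hKt⟩
  refine ne_top_of_le_ne_top h3 (ENNReal.tsum_le_tsum fun k => ?_)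
  rw [ENNReal.ofReal_add (by positivity) zero_le_one, ENNReal.ofReal_one]
  calc π k * (ENNReal.ofReal (|Real.log (π k).toReal| / J) + 1) ^ m
      ≤ π k * (ENNReal.ofReal 2 * ENNReal.ofReal (|Real.log (π k).toReal| / J) ^ m + K * 1 ^ m) := by
        gcongr
        exact hK _ _
    _ = _ := by rw [ENNReal.one_rpow]; ring

theorem exists_tsum_tauA_delay_le (hI : klNumber f₁ f₀ ≠ ∞) {J : ℝ} (hJ : 0 < J)
    (hJI : J < (klNumber f₁ f₀).toReal) {m : ℝ} (hm : 0 < m) {η : ℝ} (hη : 1 < η)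
    {π : PMF ℕ} (hπ : π 0 = 0)
    (hπ_sum : Summable fun k : ℕ => |Real.log (π k).toReal| ^ m * (π k).toReal) :
    ∃ C : ℝ≥0∞, C ≠ ∞ ∧ ∀ A : ℝ, 1 < A →
      ∑' k : ℕ, π k * ∫⁻ ω in {ω | (k : ℕ∞) ≤ tauA f₀ f₁ π A ω},
        ((tauA f₀ f₁ π A ω : ℝ≥0∞) - (k : ℝ≥0∞)) ^ m ∂changeMeasure f₀ f₁ k ≤
      ENNReal.ofReal η * ENNReal.ofReal (Real.log A / J) ^ m + C := by
  have hac := (InformationTheory.klDiv_ne_top_iff.1 hI).1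
  obtain ⟨t, ht, htJ⟩ := exists_lintegral_exp_neg_mul_logLR_le hI hJI
  obtain ⟨K, hKt, hK⟩ := exists_add_rpow_le hm hη
  have hS := tsum_rpow_mul_exp_ne_top m (mul_pos ht hJ)
  set S := ∑' j : ℕ, ((j + 1 : ℕ) : ℝ≥0∞) ^ m * ENNReal.ofReal (Real.exp (-(t * J * j)))
  have hB := tsum_mul_ofReal_abs_log_rpow_ne_top hm hπ_sum hJ
  set B := ∑' k : ℕ, π k * ENNReal.ofReal (|Real.log (π k).toReal| / J + 1) ^ m
  refine ⟨K * (ENNReal.ofReal η * B + K * S), ?_, fun A hA => ?_⟩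
  · exact ENNReal.mul_ne_top hKt (ENNReal.add_ne_top.2
      ⟨ENNReal.mul_ne_top ENNReal.ofReal_ne_top hB, ENNReal.mul_ne_top hKt hS⟩)
  calc _ ≤ ∑' k : ℕ, (π k * (ENNReal.ofReal η * ENNReal.ofReal (Real.log A / J) ^ m) +
        K * (ENNReal.ofReal η * (π k * ENNReal.ofReal (|Real.log (π k).toReal| / J + 1) ^ m) +
          π k * (K * S))) := by
        refine ENNReal.tsum_le_tsum fun k => ?_
        by_cases hk : π k = 0
        · simp [hk]
        have hk1 : 1 ≤ k := Nat.one_le_iff_ne_zero.2 fun h => hk (h ▸ hπ)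
        refine (mul_le_mul_right (lintegral_tauA_delay_le hac ht hJ htJ hm hK hK hπ hA hk1 hk)
          _).trans (le_of_eq ?_)
        ring
    _ = _ := by
        rw [ENNReal.tsum_add, ENNReal.tsum_mul_right, ENNReal.tsum_mul_left, ENNReal.tsum_add,
          ENNReal.tsum_mul_left, ENNReal.tsum_mul_right, π.tsum_coe, one_mul, one_mul]

theorem eventually_delayMoment_tauA_le (hI_pos : 0 < klNumber f₁ f₀) (hI : klNumber f₁ f₀ ≠ ∞)
    {m : ℝ} (hm : 0 < m) {π : PMF ℕ} (hπ : π 0 = 0)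
    (hπ_sum : Summable fun k : ℕ => |Real.log (π k).toReal| ^ m * (π k).toReal)
    {c : ℝ} (hc : 1 < c) :
    ∀ᶠ A : ℝ in atTop, delayMoment f₀ f₁ π m (tauA f₀ f₁ π A) ≤
      ENNReal.ofReal c *
        ENNReal.ofReal ((Real.log A / (klNumber f₁ f₀).toReal) ^ m) := by
  have hac := (InformationTheory.klDiv_ne_top_iff.1 hI).1
  set I := (klNumber f₁ f₀).toReal
  have hI0 : 0 < I := ENNReal.toReal_pos hI_pos.ne' hI
  -- Four losses of a factor `η`: splitting the power, replacing `I` by `I / s`, absorbing `C`, and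
  -- dividing by `P^π(τ ≥ λ)`.
  set η := c ^ (1 / 4 : ℝ) with hη_def
  have hη : 1 < η := Real.one_lt_rpow hc (by norm_num)
  have hη0 : 0 < η := zero_lt_one.trans hη
  have hη4 : η ^ 4 = c := by
    rw [hη_def, ← Real.rpow_natCast, ← Real.rpow_mul (by linarith)]
    norm_num
  set s := η ^ (1 / m) with hs_def
  have hs : 1 < s := Real.one_lt_rpow hη (by positivity)
  have hsm : s ^ m = η := by
    rw [hs_def, ← Real.rpow_mul hη0.le, one_div_mul_cancel hm.ne', Real.rpow_one]
  have hs0 : 0 < s := zero_lt_one.trans hs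
  obtain ⟨C, hCt, hC⟩ := exists_tsum_tauA_delay_le hI (div_pos hI0 hs0) (div_lt_self hI0 hs) hm hη
    hπ hπ_sum
  have hX : Tendsto (fun A : ℝ => (Real.log A / I) ^ m) atTop atTop :=
    (tendsto_rpow_atTop hm).comp (Real.tendsto_log_atTop.atTop_div_const hI0)
  have h1 : ∀ᶠ A : ℝ in atTop, C.toReal / (η ^ 3 - η ^ 2) ≤ (Real.log A / I) ^ m :=
    hX.eventually_ge_atTop _
  have h2 : ∀ᶠ A : ℝ in atTop, η⁻¹ < 1 - 1 / A := by
    have : Tendsto (fun A : ℝ => 1 - 1 / A) atTop (𝓝 (1 - 0)) := by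
      simpa only [one_div] using tendsto_const_nhds.sub tendsto_inv_atTop_zero
    rw [sub_zero] at this
    exact this.eventually (lt_mem_nhds (inv_lt_one_of_one_lt₀ hη))
  filter_upwards [h1, h2, eventually_gt_atTop 1] with A hA1 hA2 hA
  have hl : 0 < Real.log A := Real.log_pos hA
  have hη3 : 0 < η ^ 3 - η ^ 2 := by
    have : 0 < η ^ 2 * (η - 1) := mul_pos (by positivity) (by linarith)
    linarith
  rw [div_le_iff₀ hη3] at hA1
  have hden : ENNReal.ofReal η⁻¹ ≤
      ∑' k : ℕ, π k * changeMeasure f₀ f₁ k {ω | (k : ℕ∞) ≤ tauA f₀ f₁ π A ω} :=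
    (ENNReal.ofReal_le_ofReal hA2.le).trans
      (ofReal_one_sub_le_tsum hπ (by positivity) (tauA_mem_falseAlarmClass hac hπ (by positivity)))
  refine ENNReal.div_le_of_le_mul ?_
  calc _ ≤ ENNReal.ofReal η * ENNReal.ofReal (Real.log A / (I / s)) ^ m + C := hC A hA
    _ = ENNReal.ofReal (η * (η * (Real.log A / I) ^ m) + C.toReal) := by
        rw [ENNReal.ofReal_add (by positivity) ENNReal.toReal_nonneg, ENNReal.ofReal_toReal hCt,
          ENNReal.ofReal_mul hη0.le, ENNReal.ofReal_rpow_of_nonneg (by positivity) hm.le,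
          div_div_eq_mul_div, mul_comm (Real.log A), mul_div_assoc,
          Real.mul_rpow hs0.le (by positivity), hsm]
    _ ≤ ENNReal.ofReal (c * (Real.log A / I) ^ m * η⁻¹) := by
        refine ENNReal.ofReal_le_ofReal ?_
        rw [← hη4, show η ^ 4 * (Real.log A / I) ^ m * η⁻¹ = η ^ 3 * (Real.log A / I) ^ m by
          field_simp]
        linarith
    _ ≤ _ := by
        rw [ENNReal.ofReal_mul (by positivity), ENNReal.ofReal_mul (by positivity)]
        gcongr

end UpperBound

/-! ### Lower bound over the whole false alarm class. -/

section LowerBound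

variable {E : Type*} [MeasurableSpace E] {μ : Measure E} {f₀ f₁ : ProbDensity μ}

theorem changeMeasure_le_and_lt_add_le (hac : f₁.law ≪ f₀.law) {τ : (ℕ → E) → ℕ∞} {α : ℝ}
    (hτ : τ ∈ falseAlarmClass f₀ f₁ α) {J : ℝ} (hJ : 0 ≤ J) (C : ℝ) {k : ℕ} (hk : 1 ≤ k) (N : ℕ) :
    changeMeasure f₀ f₁ k {ω | (k : ℕ∞) ≤ τ ω ∧ τ ω < ((k + N : ℕ) : ℕ∞)} ≤
      (Measure.infinitePi fun _ : ℕ => f₁.law)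
        {ω | ∃ n : ℕ, ENNReal.ofReal (Real.exp (C + J * n)) ≤
          ∏ i ∈ Finset.range n, lr f₀ f₁ (ω i)} +
      ENNReal.ofReal (Real.exp (C + J * N)) * ENNReal.ofReal α := by
  set S : Set (ℕ → E) := {ω | ∃ n : ℕ, ENNReal.ofReal (Real.exp (C + J * n)) ≤
          ∏ i ∈ Finset.range n, lr f₀ f₁ (ω i)} with hS
  have hSm : MeasurableSet S := by
    simp only [S, Set.ofPred_exists]
    exact .iUnion fun n => measurableSet_le measurable_const
      (Finset.measurable_prod _ fun i _ => (measurable_lr f₀ f₁).comp (measurable_pi_apply i))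
  set c := ENNReal.ofReal (Real.exp (C + J * N)) with hc
  have hsub : {ω | (k : ℕ∞) ≤ τ ω ∧ τ ω < ((k + N : ℕ) : ℕ∞)} ⊆
      (fun (ω : ℕ → E) i => ω (k + i)) ⁻¹' S ∪
        ⋃ n : ℕ, ({ω | τ ω = ((k + n : ℕ) : ℕ∞)} ∩ {ω | lrProd f₀ f₁ k (k + n) ω < c}) := by
    rintro ω ⟨h1, h2⟩
    obtain ⟨x, hx⟩ := ENat.ne_top_iff_exists.1 (ne_top_of_lt h2)
    rw [← hx] at h1 h2
    norm_cast at h1 h2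
    obtain ⟨n, rfl⟩ := Nat.exists_eq_add_of_le h1
    by_cases h : lrProd f₀ f₁ k (k + n) ω < c
    · exact .inr (Set.mem_iUnion.2 ⟨n, hx.symm, h⟩)
    -- The observations `X_k, …, X_{k+n}` number `n + 1 ≤ N`, so a product of at least `e^{C+JN}`
    -- also exceeds `e^{C+J(n+1)}`.
    · refine .inl ⟨n + 1, ?_⟩
      rw [not_lt, lrProd_add] at h
      refine le_trans (ENNReal.ofReal_le_ofReal (Real.exp_le_exp.2 ?_)) h
      have : ((n + 1 : ℕ) : ℝ) ≤ N := by exact_mod_cast (by omega : n + 1 ≤ N)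
      gcongr
  refine (measure_mono hsub).trans ((measure_union_le _ _).trans (add_le_add (le_of_eq ?_) ?_))
  · rw [← changeMeasure_map_shift (f₀ := f₀) k, Measure.map_apply (by fun_prop) hSm]
  · calc _ ≤ ∑' n : ℕ, changeMeasure f₀ f₁ k
          ({ω | τ ω = ((k + n : ℕ) : ℕ∞)} ∩ {ω | lrProd f₀ f₁ k (k + n) ω < c}) :=
          measure_iUnion_le _
      _ ≤ ∑' n : ℕ, c * changeMeasure f₀ f₁ ⊤ {ω | τ ω = ((k + n : ℕ) : ℕ∞)} :=
          ENNReal.tsum_le_tsum fun n =>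
            changeMeasure_inter_lt_le hac hk (hτ.1.measurableSet_eq (k + n)) c
      _ = c * ∑' n : ℕ, changeMeasure f₀ f₁ ⊤ {ω | τ ω = ((k + n : ℕ) : ℕ∞)} :=
          ENNReal.tsum_mul_left
      _ ≤ c * changeMeasure f₀ f₁ ⊤ {ω | τ ω < ⊤} := by
          rw [measure_lt_top_eq_tsum _ hτ.1]
          exact mul_le_mul_right (ENNReal.tsum_comp_le_tsum_of_injective (add_right_injective k)
            fun n : ℕ => changeMeasure f₀ f₁ ⊤ {ω | τ ω = (n : ℕ∞)}) c
      _ ≤ _ := by gcongr; exact hτ.2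

theorem le_delayMoment (hac : f₁.law ≪ f₀.law) {π : PMF ℕ} (hπ : π 0 = 0) {m : ℝ} (hm : 0 < m)
    {τ : (ℕ → E) → ℕ∞} {α : ℝ} (hα : 0 ≤ α)
    (hτ : τ ∈ falseAlarmClass f₀ f₁ α) {J : ℝ} (hJ : 0 ≤ J) (C : ℝ) (N : ℕ) :
    (N : ℝ≥0∞) ^ m * (ENNReal.ofReal (1 - α) -
      ((Measure.infinitePi fun _ : ℕ => f₁.law)
        {ω | ∃ n : ℕ, ENNReal.ofReal (Real.exp (C + J * n)) ≤
          ∏ i ∈ Finset.range n, lr f₀ f₁ (ω i)} +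
      ENNReal.ofReal (Real.exp (C + J * N)) * ENNReal.ofReal α)) ≤ delayMoment f₀ f₁ π m τ := by
  set δ := (Measure.infinitePi fun _ : ℕ => f₁.law)
        {ω | ∃ n : ℕ, ENNReal.ofReal (Real.exp (C + J * n)) ≤
          ∏ i ∈ Finset.range n, lr f₀ f₁ (ω i)} +
      ENNReal.ofReal (Real.exp (C + J * N)) * ENNReal.ofReal α with hδ
  have h1 : ENNReal.ofReal (1 - α) ≤
      ∑' k : ℕ, π k * changeMeasure f₀ f₁ k {ω | ((k + N : ℕ) : ℕ∞) ≤ τ ω} + δ := by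
    refine (ofReal_one_sub_le_tsum hπ hα hτ).trans ?_
    calc _ ≤ ∑' k : ℕ, (π k * changeMeasure f₀ f₁ k {ω | ((k + N : ℕ) : ℕ∞) ≤ τ ω} + π k * δ) := by
          refine ENNReal.tsum_le_tsum fun k => ?_
          rcases Nat.eq_zero_or_pos k with rfl | hk
          · simp [hπ]
          rw [← mul_add]
          gcongr
          refine le_trans (measure_mono fun ω hω => ?_) ((measure_union_le _ _).trans
            (add_le_add_right (changeMeasure_le_and_lt_add_le hac hτ hJ C hk N) _))
          rcases le_or_gt ((k + N : ℕ) : ℕ∞) (τ ω) with h | h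
          · exact .inl h
          · exact .inr ⟨hω, h⟩
      _ = _ := by rw [ENNReal.tsum_add, ENNReal.tsum_mul_right, π.tsum_coe, one_mul]
  have hmeas : ∀ n : ℕ, MeasurableSet {ω | (n : ℕ∞) ≤ τ ω} := fun n => by
    have h : MeasurableSet {ω | τ ω < (n : ℕ∞)} :=
      (obsFiltration E).le n _ (hτ.1.measurableSet_lt n)
    convert h.compl using 1
    ext ω
    simp
  have h2 : (N : ℝ≥0∞) ^ m *
      ∑' k : ℕ, π k * changeMeasure f₀ f₁ k {ω | ((k + N : ℕ) : ℕ∞) ≤ τ ω} ≤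
      ∑' k : ℕ, π k * ∫⁻ ω in {ω | (k : ℕ∞) ≤ τ ω},
        ((τ ω : ℝ≥0∞) - (k : ℝ≥0∞)) ^ m ∂(changeMeasure f₀ f₁ k) := by
    rw [← ENNReal.tsum_mul_left]
    refine ENNReal.tsum_le_tsum fun k => ?_
    rw [mul_left_comm]
    gcongr
    rw [← setLIntegral_const]
    refine le_trans (setLIntegral_mono' (hmeas _) fun ω hω => ?_)
      (lintegral_mono_set (s := {ω | ((k + N : ℕ) : ℕ∞) ≤ τ ω}) fun ω hω => ?_)
    · refine ENNReal.rpow_le_rpow ?_ hm.le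
      have h : (((k + N : ℕ) : ℕ∞) : ℝ≥0∞) ≤ τ ω := ENat.toENNReal_le.2 hω
      refine ENNReal.le_sub_of_add_le_left (ENNReal.natCast_ne_top k) ?_
      simpa using h
    · exact le_trans (by exact_mod_cast Nat.le_add_right k N) (show _ ≤ τ ω from hω)
  calc _ ≤ (N : ℝ≥0∞) ^ m *
        ∑' k : ℕ, π k * changeMeasure f₀ f₁ k {ω | ((k + N : ℕ) : ℕ∞) ≤ τ ω} := by
        gcongr
        exact tsub_le_iff_right.2 h1
    _ ≤ _ := h2
    _ ≤ _ := by
        rw [delayMoment]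
        conv_lhs => rw [← div_one (tsum _)]
        exact ENNReal.div_le_div_left (tsum_changeMeasure_le_one π _) _

theorem eventually_le_delayMoment (hI_pos : 0 < klNumber f₁ f₀) (hI : klNumber f₁ f₀ ≠ ∞)
    {m : ℝ} (hm : 0 < m) {π : PMF ℕ} (hπ : π 0 = 0) {c : ℝ} (hc0 : 0 < c) (hc : c < 1) :
    ∀ᶠ A : ℝ in atTop, ∀ τ ∈ falseAlarmClass f₀ f₁ (1 / A),
      ENNReal.ofReal c * ENNReal.ofReal ((Real.log A / (klNumber f₁ f₀).toReal) ^ m) ≤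
        delayMoment f₀ f₁ π m τ := by
  have hac := (InformationTheory.klDiv_ne_top_iff.1 hI).1
  set I := (klNumber f₁ f₀).toReal
  have hI0 : 0 < I := ENNReal.toReal_pos hI_pos.ne' hI
  -- Three losses of a factor `ρ`: replacing `I` by `J = I / s`, rounding `N` down, and the
  -- probability that the delay is at least `N`.
  set ρ := c ^ (1 / 3 : ℝ) with hρ_def
  have hρ0 : 0 < ρ := Real.rpow_pos_of_pos hc0 _
  have hρ1 : ρ < 1 := Real.rpow_lt_one hc0.le hc (by norm_num)
  have hρ3 : ρ ^ 3 = c := by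
    rw [hρ_def, ← Real.rpow_natCast, ← Real.rpow_mul hc0.le]
    norm_num
  set s := ρ ^ (1 / m) with hs_def
  have hs0 : 0 < s := Real.rpow_pos_of_pos hρ0 _
  have hs1 : s < 1 := Real.rpow_lt_one hρ0.le hρ1 (by positivity)
  have hsm : s ^ m = ρ := by
    rw [hs_def, ← Real.rpow_mul hρ0.le, one_div_mul_cancel hm.ne', Real.rpow_one]
  set J := I / s with hJ_def
  have hIJ : I < J := by rw [hJ_def, lt_div_iff₀ hs0]; nlinarith
  have hJ0 : 0 < J := hI0.trans hIJ
  -- The walk is compared with slope `J' > I`, while `N ≈ log A / J` with `J > J'`. The slack `r`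
  -- lets `C = (r/2) log A` tend to infinity while `e^{C+J'N}/A ≤ e^{-(r/2) log A}` still vanishes.
  set J' := (I + J) / 2 with hJ'_def
  have hJ'0 : 0 < J' := by linarith
  set r := 1 - J' / J with hr_def
  have hr0 : 0 < r := by
    have : J' / J < 1 := by rw [div_lt_one hJ0]; linarith
    linarith
  have hlog := Real.tendsto_log_atTop
  have hC : Tendsto (fun A : ℝ => r / 2 * Real.log A) atTop atTop :=
    hlog.const_mul_atTop (by positivity)
  have hq := (tendsto_infinitePi_exists_le_prod_lr (f₀ := f₀) (f₁ := f₁) hI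
    (show I < J' by linarith)).comp hC
  have hexp : Tendsto (fun A : ℝ => ENNReal.ofReal (Real.exp (-(r / 2 * Real.log A)))) atTop
      (𝓝 0) := by
    rw [← ENNReal.ofReal_zero]
    exact (ENNReal.continuous_ofReal.tendsto 0).comp
      (Real.tendsto_exp_neg_atTop_nhds_zero.comp hC)
  have hone : Tendsto (fun A : ℝ => ENNReal.ofReal (1 - 1 / A)) atTop (𝓝 1) := by
    have : Tendsto (fun A : ℝ => 1 - 1 / A) atTop (𝓝 (1 - 0)) := by
      simpa only [one_div] using tendsto_const_nhds.sub tendsto_inv_atTop_zero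
    rw [sub_zero] at this
    rw [← ENNReal.ofReal_one]
    exact (ENNReal.continuous_ofReal.tendsto 1).comp this
  have hlim := ENNReal.Tendsto.sub hone (hq.add hexp) (.inl ENNReal.one_ne_top)
  rw [add_zero, tsub_zero] at hlim
  have hev := hlim.eventually (lt_mem_nhds (ENNReal.ofReal_lt_one.2 hρ1))
  filter_upwards [hev, eventually_gt_atTop 1, hlog.eventually_ge_atTop (J / (1 - s))]
    with A hA1 hA hA2 τ hτ
  set x := Real.log A with hx_def
  have hx0 : 0 < x := Real.log_pos hA
  set N := ⌊x / J⌋₊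
  have hN1 : J * N ≤ x := by
    have := Nat.floor_le (by positivity : 0 ≤ x / J)
    rw [le_div_iff₀ hJ0] at this
    linarith
  have hN2 : s * (x / J) ≤ N := by
    have h1 := Nat.lt_floor_add_one (x / J)
    have h2 : 1 ≤ (1 - s) * (x / J) := by
      rw [div_le_iff₀ (by linarith)] at hA2
      rw [← mul_div_assoc, le_div_iff₀ hJ0]
      linarith
    change x / J < (N : ℝ) + 1 at h1
    linarith
  have hNm : ENNReal.ofReal (ρ ^ 2 * (x / I) ^ m) ≤ (N : ℝ≥0∞) ^ m := by
    rw [← ENNReal.ofReal_natCast, ENNReal.ofReal_rpow_of_nonneg (Nat.cast_nonneg _) hm.le]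
    refine ENNReal.ofReal_le_ofReal ?_
    have h : ρ ^ 2 * (x / I) ^ m = (s * (x / J)) ^ m := by
      rw [hJ_def, show s * (x / (I / s)) = s * s * (x / I) by field_simp,
        Real.mul_rpow (by positivity) (by positivity), Real.mul_rpow hs0.le hs0.le, hsm, sq]
    rw [h]
    exact Real.rpow_le_rpow (by positivity) hN2 hm.le
  refine le_trans ?_ (le_delayMoment hac hπ hm (by positivity : 0 ≤ 1 / A) hτ hJ'0.le
    (r / 2 * x) N)
  calc _ = ENNReal.ofReal (ρ ^ 2 * (x / I) ^ m) * ENNReal.ofReal ρ := by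
        rw [← ENNReal.ofReal_mul hc0.le, ← ENNReal.ofReal_mul (by positivity), ← hρ3]
        congr 1
        ring
    _ ≤ _ := by
        refine mul_le_mul' hNm (hA1.le.trans ?_)
        refine tsub_le_tsub_left (add_le_add_right ?_ _) _
        rw [← ENNReal.ofReal_mul (Real.exp_pos _).le]
        refine ENNReal.ofReal_le_ofReal ?_
        have hAe : 1 / A = Real.exp (-x) := by
          rw [Real.exp_neg, hx_def, Real.exp_log (by linarith), one_div]
        rw [hAe, ← Real.exp_add, Real.exp_le_exp]
        have h : J' * N ≤ (1 - r) * x := by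
          have e : (1 - r) * J = J' := by rw [hr_def]; field_simp; ring
          have h1r : 0 ≤ 1 - r := by rw [hr_def, sub_sub_cancel]; positivity
          calc J' * N = (1 - r) * (J * N) := by rw [← mul_assoc, e]
            _ ≤ _ := mul_le_mul_of_nonneg_left hN1 h1r
        linarith

end LowerBound

/-! ### From two-sided bounds to asymptotic equivalence. -/

theorem asympEquiv_of_eventually_le {ι : Type*} {l : Filter ι} {u v : ι → ℝ≥0∞}
    (hv0 : ∀ᶠ i in l, v i ≠ 0) (hvt : ∀ᶠ i in l, v i ≠ ∞)
    (hle : ∀ c : ℝ, 1 < c → ∀ᶠ i in l, u i ≤ ENNReal.ofReal c * v i)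
    (hge : ∀ c : ℝ, 0 < c → c < 1 → ∀ᶠ i in l, ENNReal.ofReal c * v i ≤ u i) :
    AsympEquiv l u v := by
  refine tendsto_order.2 ⟨fun b hb => ?_, fun b hb => ?_⟩
  · obtain ⟨c, hbc, hc1⟩ := exists_between hb
    have hct : c ≠ ∞ := ne_top_of_lt hc1
    have hc0 : 0 < c.toReal := ENNReal.toReal_pos (zero_le.trans_lt hbc).ne' hct
    have hc1' : c.toReal < 1 := by
      rw [← ENNReal.toReal_one]
      exact (ENNReal.toReal_lt_toReal hct ENNReal.one_ne_top).2 hc1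
    filter_upwards [hv0, hvt, hge _ hc0 hc1'] with i h0 ht h
    rw [ENNReal.ofReal_toReal hct] at h
    exact hbc.trans_le ((ENNReal.le_div_iff_mul_le (.inl h0) (.inl ht)).2 h)
  · obtain ⟨c, hc1, hcb⟩ := exists_between hb
    have hct : c ≠ ∞ := ne_top_of_lt hcb
    have hc1' : 1 < c.toReal := by
      rw [← ENNReal.toReal_one]
      exact (ENNReal.toReal_lt_toReal ENNReal.one_ne_top hct).2 hc1
    filter_upwards [hle _ hc1'] with i h
    rw [ENNReal.ofReal_toReal hct] at h
    exact (ENNReal.div_le_of_le_mul h).trans_lt hcb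

end ChangePoint

open ChangePoint
theorem theorem2 {E : Type*} [MeasurableSpace E] (μ : Measure E) [SigmaFinite μ]
    (f₀ f₁ : ProbDensity μ)
    (hI_pos : 0 < klNumber f₁ f₀) (hI_fin : klNumber f₁ f₀ < ∞)
    (π : PMF ℕ) (hπ_zero : π 0 = 0)
    (m : ℝ) (hm : 0 < m)
    (hπ_sum : Summable fun k : ℕ => |Real.log (π k).toReal| ^ m * (π k).toReal) :
    AsympEquiv atTop
        (fun A : ℝ => delayMoment f₀ f₁ π m (tauA f₀ f₁ π A))
        (fun A : ℝ => ENNReal.ofReal ((Real.log A / (klNumber f₁ f₀).toReal) ^ m)) ∧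
    (∀ α : ℝ, 0 < α → α < 1 → tauA f₀ f₁ π (1 / α) ∈ falseAlarmClass f₀ f₁ α) ∧
    AsympEquiv (𝓝[>] (0 : ℝ))
        (fun α : ℝ => ⨅ τ ∈ falseAlarmClass f₀ f₁ α, delayMoment f₀ f₁ π m τ)
        (fun α : ℝ => delayMoment f₀ f₁ π m (tauA f₀ f₁ π (1 / α))) ∧
    AsympEquiv (𝓝[>] (0 : ℝ))
        (fun α : ℝ => delayMoment f₀ f₁ π m (tauA f₀ f₁ π (1 / α)))
        (fun α : ℝ => ENNReal.ofReal ((|Real.log α| / (klNumber f₁ f₀).toReal) ^ m)) := by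
  have hI := hI_fin.ne
  have hac := (InformationTheory.klDiv_ne_top_iff.1 hI).1
  have hI0 : 0 < (klNumber f₁ f₀).toReal := ENNReal.toReal_pos hI_pos.ne' hI
  set w : ℝ → ℝ≥0∞ := fun A => ENNReal.ofReal ((Real.log A / (klNumber f₁ f₀).toReal) ^ m)
    with hw
  set D : ℝ → ℝ≥0∞ := fun A => delayMoment f₀ f₁ π m (tauA f₀ f₁ π A) with hD
  have hw0 : ∀ᶠ A in atTop, w A ≠ 0 := by
    filter_upwards [eventually_gt_atTop 1] with A hA
    have := Real.log_pos hA
    exact (ENNReal.ofReal_pos.2 (by positivity)).ne'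
  have hwt : ∀ A, w A ≠ ∞ := fun A => ENNReal.ofReal_ne_top
  have hup : ∀ c : ℝ, 1 < c → ∀ᶠ A in atTop, D A ≤ ENNReal.ofReal c * w A := fun c hc =>
    eventually_delayMoment_tauA_le hI_pos hI hm hπ_zero hπ_sum hc
  have hinf : ∀ c : ℝ, 0 < c → c < 1 → ∀ᶠ A in atTop, ENNReal.ofReal c * w A ≤
      ⨅ τ ∈ falseAlarmClass f₀ f₁ (1 / A), delayMoment f₀ f₁ π m τ := fun c hc0 hc1 => by
    filter_upwards [eventually_le_delayMoment hI_pos hI hm hπ_zero hc0 hc1] with A hA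
    exact le_iInf₂ hA
  have hinfD : ∀ᶠ A in atTop,
      ⨅ τ ∈ falseAlarmClass f₀ f₁ (1 / A), delayMoment f₀ f₁ π m τ ≤ D A := by
    filter_upwards [eventually_gt_atTop 0] with A hA
    exact iInf₂_le _ (tauA_mem_falseAlarmClass hac hπ_zero hA)
  have hlow : ∀ c : ℝ, 0 < c → c < 1 → ∀ᶠ A in atTop, ENNReal.ofReal c * w A ≤ D A :=
    fun c hc0 hc1 => by
      filter_upwards [hinf c hc0 hc1, hinfD] with A h1 h2
      exact h1.trans h2
  have hfirst : AsympEquiv atTop D w :=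
    asympEquiv_of_eventually_le hw0 (.of_forall hwt) hup hlow
  have hD0 : ∀ᶠ A in atTop, D A ≠ 0 := by
    filter_upwards [hw0, hlow (1 / 2) (by norm_num) (by norm_num)] with A h0 h
    refine ne_bot_of_le_ne_bot (mul_ne_zero ?_ h0) h
    simp
  have hDt : ∀ᶠ A in atTop, D A ≠ ∞ := by
    filter_upwards [hup 2 one_lt_two] with A h
    exact ne_top_of_le_ne_top (ENNReal.mul_ne_top ENNReal.ofReal_ne_top (hwt A)) h
  have hsecond : AsympEquiv atTop
      (fun A => ⨅ τ ∈ falseAlarmClass f₀ f₁ (1 / A), delayMoment f₀ f₁ π m τ) D := by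
    refine asympEquiv_of_eventually_le hD0 hDt (fun c hc => ?_) (fun c hc0 hc1 => ?_)
    · filter_upwards [hinfD] with A h
      refine h.trans (le_mul_of_one_le_left' ?_)
      simpa using hc.le
    -- The loss `c` is shared equally: `√c` between the infimum and `w`, and `√c` between `w` and
    -- `D`.
    · have hs0 : 0 < √c := Real.sqrt_pos.2 hc0
      have hs1 : √c < 1 := by rwa [Real.sqrt_lt' one_pos, one_pow]
      filter_upwards [hinf _ hs0 hs1, hup _ (one_lt_inv₀ hs0 |>.2 hs1)] with A h1 h2
      calc ENNReal.ofReal c * D A ≤ ENNReal.ofReal c * (ENNReal.ofReal (√c)⁻¹ * w A) := by gcongr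
        _ = ENNReal.ofReal (√c) * w A := by
            rw [← mul_assoc, ← ENNReal.ofReal_mul hc0.le]
            congr 2
            rw [← div_eq_mul_inv, Real.div_sqrt]
        _ ≤ _ := h1
  have hinv : Tendsto (fun α : ℝ => 1 / α) (𝓝[>] 0) atTop := by
    simpa only [one_div] using tendsto_inv_nhdsGT_zero (𝕜 := ℝ)
  refine ⟨hfirst, fun α hα0 _ => ?_, ?_, ?_⟩
  · simpa only [one_div_one_div] using
      tauA_mem_falseAlarmClass (f₀ := f₀) (f₁ := f₁) (A := 1 / α) hac hπ_zero (by positivity)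
  · have h := hsecond.comp hinv
    simpa only [AsympEquiv, Function.comp_def, one_div_one_div] using h
  · refine (hfirst.comp hinv).congr' ?_
    filter_upwards [Ioo_mem_nhdsGT one_pos] with α hα
    simp only [Function.comp_apply, hw, hD]
    rw [abs_of_neg (Real.log_neg hα.1 hα.2), one_div, Real.log_inv]
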